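/- Let $n\ge 1$ and let $B_n$ be the group of signed permutations, i.e. permutations $\pi$ of $\{-n,\dots,n\}$ with $\pi(-i)=-\pi(i)$ for all $i$. Put $\mathrm{Des}(\pi)=\{0\le i\le n-1 : \pi(i)>\pi(i+1)\}$. A signed permutation $\pi\in B_n$ is a *signed arc permutation* if for every $1\le i\le n-1$: the set $P_i=\{|\pi(1)|,\dots,|\pi(i-1)|\}$ is a (possibly empty, cyclic) interval in $\mathbb Z_n$; $\pi(i)>0$ if $|\pi(i)|-1\in P_i$; and $\pi(i)<0$ if $|\pi(i)|+1\in P_i$ (arithmetic in $\mathbb Z_n$). Let $\mathcal A^s_n$ be the set of signed arc permutations in $B_n$. For $I\subseteq\{0,\dots,n-1\}$, Chow's type B fundamental quasisymmetric function in the variables $X=\{x_0,x_1,x_2,\dots\}$ is the formal power series $$F^B_I(X)=\sum_{\substack{0=i_0\le i_1\le\cdots\le i_n\\ j\in I\Rightarrow i_j<i_{j+1}}}x_{i_1}x_{i_2}\cdots x_{i_n}.$$ Let $\mathcal P^0(n)$ be the set of partitions $\lambda$ of $2n$ whose Young diagram can be tiled by dominoes. For $\lambda\in\mathcal P^0(n)$,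 a semistandard domino tableau of shape $\lambda$ is a tiling of the Young diagram of $\lambda$ by dominoes labelled with integers in $\{0,1,2,\dots\}$ such that the labels are non-decreasing along the rows and strictly increasing down the columns (from one domino to the next) and such that, if the domino covering the top left cell is vertical, its label is not $0$. The domino function $\mathcal G_\lambda(X)$ is $\sum_T\prod_{d}x_{T(d)}$, where $T$ runs over all semistandard domino tableaux of shape $\lambda$, $d$ over the dominoes of $T$, and $T(d)$ is the label of $d$. A set $\mathcal B\subseteq B_n$ is *$\mathcal G$-positive* (type B Schur-positive) if $\sum_{\pi\in\mathcal B}F^B_{\mathrm{Des}(\pi)}$ is a linear combination with non-negative integer coefficients of the functions $\mathcal G_\lambda$, $\lambda\in\mathcal P^0(n)$. **Theorem.** For every $n\ge1$ the set $\mathcal A^s_n$ is $\mathcal G$-positive. Moreover, for $n\ge 2$, $$\sum_{\pi\in\mathcal A^s_n}F^B_{\mathrm{Des}(\pi)}=\mathcal G_{(2n)}+\mathcal G_{(2n-1,1)}+\mathcal G_{(2n-2,1,1)}+\mathcal G_{(2n-3,1,1,1)}+2\sum_{a\ge 2n-a\ge 2}\mathcal G_{(a,2n-a)}+\sum_{a\ge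 2n-a-2\ge 2}\mathcal G_{(a,2n-a-2,2)}+\sum_{a\ge 2n-a-2\ge 2}\mathcal G_{(a,2n-a-2,1,1)},$$ the sums being over all integers $a$ in the indicated ranges; and for $n=1$ the left-hand side equals $\mathcal G_{(2)}+\mathcal G_{(1,1)}$. -/

import Mathlib

open Finset

noncomputable section

/-! ### Signed permutations -/

/-- The hyperoctahedral group `B_n`: permutations `π` of `{-n, …, n}` with `π (-i) = -π i`. -/
abbrev SignedPerm (n : ℕ) : Type :=
  {π : Equiv.Perm (Set.Icc (-(n : ℤ)) (n : ℤ)) //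
    ∀ i j : Set.Icc (-(n : ℤ)) (n : ℤ), (j : ℤ) = -(i : ℤ) → (π j : ℤ) = -(π i : ℤ)}

/-- The integer `π(i)` for `0 ≤ i ≤ n` (and `0` outside of this range, never used). -/
def SignedPerm.val {n : ℕ} (π : SignedPerm n) (i : ℕ) : ℤ :=
  if h : i ≤ n then (π.1 ⟨(i : ℤ), by constructor <;> omega⟩ : ℤ) else 0

/-- `Des(π) = {0 ≤ i ≤ n - 1 ∣ π(i) > π(i + 1)}`. -/
def SignedPerm.des {n : ℕ} (π : SignedPerm n) : Finset ℕ :=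
  (range n).filter fun i => π.val (i + 1) < π.val i

/-- Intervals of `ℤ/nℤ` (cyclic intervals, possibly empty): `{a, a + 1, …, a + k - 1}`. -/
def IsCyclicInterval {n : ℕ} (S : Set (ZMod n)) : Prop :=
  ∃ (a : ZMod n) (k : ℕ), S = {x | ∃ t : ℕ, t < k ∧ x = a + (t : ZMod n)}

/-- The residue of `|π(i)|` in `ℤ/nℤ`. -/
def SignedPerm.absMod {n : ℕ} (π : SignedPerm n) (i : ℕ) : ZMod n :=
  ((π.val i).natAbs : ZMod n)

/-- The set `{|π(1)|, …, |π(i - 1)|}` in `ℤ/nℤ`. -/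
def SignedPerm.prefixSet {n : ℕ} (π : SignedPerm n) (i : ℕ) : Set (ZMod n) :=
  {x | ∃ j : ℕ, 1 ≤ j ∧ j < i ∧ x = π.absMod j}

/-- Signed arc permutations. The sign of the last entry `π(n)`, both of whose cyclic neighbours
have been used before it, is unrestricted. -/
def IsSignedArc {n : ℕ} (π : SignedPerm n) : Prop :=
  ∀ i : ℕ, 1 ≤ i → i < n →
    IsCyclicInterval (π.prefixSet i) ∧
    (π.absMod i - 1 ∈ π.prefixSet i → 0 < π.val i) ∧
    (π.absMod i + 1 ∈ π.prefixSet i → π.val i < 0)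

open Classical in
/-- The set `𝒜ˢ_n` of signed arc permutations in `B_n`. -/
def signedArc (n : ℕ) : Finset (SignedPerm n) :=
  univ.filter IsSignedArc

/-! ### Chow's type B quasisymmetric functions -/

/-- Chow's fundamental quasisymmetric function `F^B_I` of degree `n` in `x_0, x_1, x_2, …`: the sum
of `x_{i_1} ⋯ x_{i_n}` over `0 = i_0 ≤ i_1 ≤ ⋯ ≤ i_n` with `i_j < i_{j+1}` for all `j ∈ I`.
The coefficient of a monomial is the (finite) number of sequences that give this monomial. -/
def chowF (n : ℕ) (I : Finset ℕ) : MvPowerSeries ℕ ℂ := fun m =>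
  (Nat.card {s : Fin (n + 1) → ℕ //
    s 0 = 0 ∧ Monotone s ∧ (∀ j : Fin n, (j : ℕ) ∈ I → s j.castSucc < s j.succ) ∧
    ∑ j : Fin n, Finsupp.single (s j.succ) 1 = m} : ℂ)

/-- `𝒬(ℬ) = ∑_{π ∈ ℬ} F^B_{Des(π)}`. -/
def quasi {n : ℕ} (B : Finset (SignedPerm n)) : MvPowerSeries ℕ ℂ :=
  ∑ π ∈ B, chowF n π.des

/-! ### Domino tableaux and domino functions -/

/-- A domino in the quarter plane, given by its top left cell and its direction. -/
structure Domino where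
  row : ℕ
  col : ℕ
  vertical : Bool
deriving DecidableEq

/-- The two cells (row, column) covered by a domino. -/
def Domino.cells (d : Domino) : Finset (ℕ × ℕ) :=
  {(d.row, d.col), if d.vertical then (d.row + 1, d.col) else (d.row, d.col + 1)}

/-- `D` is a tiling of the Young diagram `μ` by dominoes. -/
def IsDominoTiling (μ : YoungDiagram) (D : Finset Domino) : Prop :=
  (∀ d ∈ D, d.cells ⊆ μ.cells) ∧ ∀ c ∈ μ.cells, ∃! d, d ∈ D ∧ c ∈ d.cells

/-- `μ ∈ 𝒫⁰(n)`: the partition `μ` of `2n` has a domino tiling, i.e. has empty 2-core. -/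
def IsDominoShape (n : ℕ) (μ : YoungDiagram) : Prop :=
  μ.card = 2 * n ∧ ∃ D, IsDominoTiling μ D

/-- Semistandard domino tableaux of shape `μ`: labels in `{0, 1, 2, …}`, non-decreasing along the
rows, strictly increasing down the columns (from one domino to the next), and a vertical domino in
the top left corner is not labelled `0`. -/
structure SSDT (μ : YoungDiagram) where
  tiles : Finset Domino
  isTiling : IsDominoTiling μ tiles
  label : tiles → ℕ
  row_weak : ∀ (d d' : tiles) (i j j' : ℕ), (i, j) ∈ d.1.cells → (i, j') ∈ d'.1.cells →
    j < j' → label d ≤ label d'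
  col_strict : ∀ (d d' : tiles) (i i' j : ℕ), d ≠ d' → (i, j) ∈ d.1.cells →
    (i', j) ∈ d'.1.cells → i < i' → label d < label d'
  corner : ∀ d : tiles, (0, 0) ∈ d.1.cells → d.1.vertical = true → label d ≠ 0

/-- The weight of a tableau, as the exponent of the monomial `X^T`. -/
def SSDT.weight {μ : YoungDiagram} (T : SSDT μ) : ℕ →₀ ℕ :=
  ∑ d : T.tiles, Finsupp.single (T.label d) 1

/-- The domino function `𝒢_μ = ∑_T X^T`, summed over the semistandard domino tableaux of shape `μ`.
The coefficient of a monomial is the (finite) number of tableaux with this weight. -/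
def dominoFun (μ : YoungDiagram) : MvPowerSeries ℕ ℂ := fun m =>
  (Nat.card {T : SSDT μ // T.weight = m} : ℂ)

open Classical in
/-- The Young diagram with row lengths `l`, for a weakly decreasing list `l` (and the empty diagram
for other lists, never used). -/
def diagram (l : List ℕ) : YoungDiagram :=
  if h : l.SortedGE then YoungDiagram.ofRowLens l h else ⊥

/-- `ℬ ⊆ B_n` is `𝒢`-positive (type B Schur-positive): `𝒬(ℬ)` is a combination, with non-negative
(integer) coefficients, of the domino functions indexed by `𝒫⁰(n)`. -/
def IsGPositive {n : ℕ} (B : Finset (SignedPerm n)) : Prop :=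
  ∃ c : YoungDiagram →₀ ℕ, (∀ μ ∈ c.support, IsDominoShape n μ) ∧
    quasi B = c.sum fun μ k => k • dominoFun μ

end

/-! ### Horizontal domino strips -/

/-! Both sides are compared coefficient by coefficient. In degree `n` the coefficient of the
monomial with exponent `m` turns out, on either side, to be `pointedCount m`: the sum of |supp p| +
|supp q| over all splittings m = p + q with p(0) = 0.

Arc permutations. Modulo `n`, the absolute values of the positive entries run upwards from some g +
1 and those of the negative entries run downwards from g. Hence a signed arc permutation is the same
as an arbitrary sign sequence together with an arbitrary position for the entry ±1
(`IsSignedArc.exists_arcWord`, `SignedPerm.eq_of_signs_eq`, `SignedPerm.exists_signedArc`). Passing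
from negative to positive is an ascent, from positive to negative a descent, and two consecutive
entries of equal sign form an ascent unless their absolute values wrap around between 1 and `n`; the
position of ±1 locates this wrap. Pairing each index of a Chow sequence with the sign of the
corresponding entry therefore gives a weakly increasing word in signed letters, ordered by value and
then negative before positive, without negative zeros, with a marked position that is the last copy
of a negative letter or the first copy of a positive one (`chow_condition_iff`). Sorted words
correspond to splittings of `m`, and each distinct letter of a word allows exactly one marked
position.

Tableaux. The dominoes with the largest label `k` form a horizontal strip, which the two shapes tile
in a unique way, so tableaux are counted by a transfer matrix between shapes
(`tabCount_add_single`). The shapes of the theorem belong to a family closed under removing strips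
(`exists_famShape_eq`), and all the transitions that occur reduce to one count: from a two-row
shape, strips of d dominoes lead to d + 1 two-row shapes (`card_filter_twoRow`). Let T count the
tableaux with two-row shapes and W those of the whole family with the multiplicities of the theorem.
Adding d > 0 dominoes with a new largest label k > 0 replaces T by (d + 1) T and W by (d + 1) W + 2
d T.

The number of splittings and `pointedCount` obey the same two recursions, since a new letter with d
copies splits in d + 1 ways and occurs with either given sign in d of them. The initial values, for
contents consisting of zeros only, agree as well, so induction on the largest label gives
`famCount_famWeight`. -/

theorem Domino.mem_cells_iff {d : Domino} {i j : ℕ} : (i, j) ∈ d.cells ↔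
    (i = d.row ∧ j = d.col) ∨ (d.vertical = true ∧ i = d.row + 1 ∧ j = d.col) ∨
      (d.vertical = false ∧ i = d.row ∧ j = d.col + 1) := by
  rcases d with ⟨r, c, _ | _⟩ <;> simp [Domino.cells]

theorem Domino.card_cells (d : Domino) : d.cells.card = 2 := by
  rcases d with ⟨r, c, _ | _⟩ <;> simp [Domino.cells]

/-- `D` is a tiling of the skew shape `ν / μ` by dominoes, no two of which meet a common column. -/
structure TilesStrip (μ ν : YoungDiagram) (D : Finset Domino) : Prop where
  sub : ∀ d ∈ D, ∀ i j, (i, j) ∈ d.cells → μ.rowLen i ≤ j ∧ j < ν.rowLen i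
  cover : ∀ i j, μ.rowLen i ≤ j → j < ν.rowLen i → ∃ d ∈ D, (i, j) ∈ d.cells
  col : ∀ d ∈ D, ∀ d' ∈ D, ∀ i i' j, (i, j) ∈ d.cells → (i', j) ∈ d'.cells → d = d'

/-- The first column of the horizontal dominoes of the strip `ν / μ` in row `i`. -/
def stripStart (μ ν : YoungDiagram) (i : ℕ) : ℕ :=
  max (μ.rowLen i) (ν.rowLen (i + 1))

/-- The end column of the horizontal dominoes of the strip `ν / μ` in row `i`. -/
def stripEnd (μ ν : YoungDiagram) : ℕ → ℕ
  | 0 => ν.rowLen 0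
  | i + 1 => min (ν.rowLen (i + 1)) (μ.rowLen i)

/-- `ν / μ` is a horizontal domino strip, in terms of the row lengths. -/
structure IsStrip (μ ν : YoungDiagram) : Prop where
  le : ∀ i, μ.rowLen i ≤ ν.rowLen i
  two : ∀ i, ν.rowLen (i + 2) ≤ μ.rowLen i
  parity : ∀ i, stripStart μ ν i % 2 = stripEnd μ ν i % 2

/-- All dominoes whose top left cell lies in `μ`. -/
def YoungDiagram.dominoes (μ : YoungDiagram) : Finset Domino :=
  (μ.cells ×ˢ (univ : Finset Bool)).image fun x => ⟨x.1.1, x.1.2, x.2⟩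

theorem YoungDiagram.mem_dominoes {μ : YoungDiagram} {d : Domino} :
    d ∈ μ.dominoes ↔ d.col < μ.rowLen d.row := by
  rw [← YoungDiagram.mem_iff_lt_rowLen, YoungDiagram.dominoes, mem_image]
  constructor
  · rintro ⟨x, hx, rfl⟩
    simpa using hx
  · intro h
    exact ⟨((d.row, d.col), d.vertical), by simpa using h, rfl⟩

/-- The tiling of a horizontal domino strip. -/
def stripTiles (μ ν : YoungDiagram) : Finset Domino :=
  ν.dominoes.filter fun d =>
    (d.vertical = true ∧ μ.rowLen d.row ≤ d.col ∧ d.col < ν.rowLen (d.row + 1)) ∨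
    (d.vertical = false ∧ stripStart μ ν d.row ≤ d.col ∧ d.col + 1 < stripEnd μ ν d.row ∧
      (d.col - stripStart μ ν d.row) % 2 = 0)

theorem stripEnd_le (μ ν : YoungDiagram) (i : ℕ) : stripEnd μ ν i ≤ ν.rowLen i := by
  cases i with
  | zero => exact le_rfl
  | succ i => exact min_le_left _ _

theorem mem_stripTiles {μ ν : YoungDiagram} {d : Domino} : d ∈ stripTiles μ ν ↔
    (d.vertical = true ∧ μ.rowLen d.row ≤ d.col ∧ d.col < ν.rowLen (d.row + 1)) ∨
    (d.vertical = false ∧ stripStart μ ν d.row ≤ d.col ∧ d.col + 1 < stripEnd μ ν d.row ∧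
      (d.col - stripStart μ ν d.row) % 2 = 0) := by
  rw [stripTiles, mem_filter, and_iff_right_iff_imp, YoungDiagram.mem_dominoes]
  rintro (⟨-, -, h⟩ | ⟨-, -, h, -⟩)
  · exact h.trans_le (ν.rowLen_anti _ _ (Nat.le_succ _))
  · have := stripEnd_le μ ν d.row
    omega

theorem lt_stripEnd_iff {μ ν : YoungDiagram} {i j : ℕ} : j < stripEnd μ ν i ↔
    j < ν.rowLen i ∧ ∀ i', i = i' + 1 → j < μ.rowLen i' := by
  cases i with
  | zero => simp [stripEnd]
  | succ i =>
    simp only [stripEnd, lt_min_iff, Nat.add_right_cancel_iff]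
    simp

theorem stripStart_le_iff {μ ν : YoungDiagram} {i j : ℕ} : stripStart μ ν i ≤ j ↔
    μ.rowLen i ≤ j ∧ ν.rowLen (i + 1) ≤ j := by
  simp [stripStart]

/-! ### Uniqueness of the tiling of a strip -/

namespace TilesStrip

variable {μ ν : YoungDiagram} {D : Finset Domino}

/-- A vertical domino on such a cell would stick out, either below into a row that `ν` has already
left, or above into `μ`. -/
theorem horizontal_of_mem (h : TilesStrip μ ν D) {i j : ℕ} (h1 : stripStart μ ν i ≤ j)
    (h2 : j < stripEnd μ ν i) :
    (⟨i, j, false⟩ : Domino) ∈ D ∨ ∃ j', j = j' + 1 ∧ (⟨i, j', false⟩ : Domino) ∈ D := by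
  rw [stripStart_le_iff] at h1
  rw [lt_stripEnd_iff] at h2
  obtain ⟨⟨r, c, v⟩, hd, hc⟩ := h.cover i j h1.1 h2.1
  have hsub := h.sub _ hd
  have hc' := hc
  rw [Domino.mem_cells_iff] at hc'
  cases v with
  | true =>
    exfalso
    rcases hc' with ⟨rfl, rfl⟩ | ⟨-, rfl, rfl⟩ | ⟨h3, -⟩
    · have := hsub (i + 1) j (by simp [Domino.mem_cells_iff])
      omega
    · have := hsub r j (by simp [Domino.mem_cells_iff])
      have := h2.2 r rfl
      omega
    · simp at h3
  | false =>
    rcases hc' with ⟨rfl, rfl⟩ | ⟨h3, -⟩ | ⟨-, rfl, rfl⟩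
    · exact Or.inl hd
    · simp at h3
    · exact Or.inr ⟨c, rfl, hd⟩

/-- If `ν` had a cell under the left half, that cell would lie outside `μ` too, so a second domino
of the strip would meet the same column. -/
theorem start_le_of_mem (h : TilesStrip μ ν D) {i j : ℕ} (hd : (⟨i, j, false⟩ : Domino) ∈ D) :
    stripStart μ ν i ≤ j := by
  have h0 := h.sub _ hd i j (by simp [Domino.mem_cells_iff])
  rw [stripStart_le_iff]
  refine ⟨h0.1, ?_⟩
  by_contra! hlt
  have := μ.rowLen_anti i (i + 1) (by omega)
  obtain ⟨d, hd', hc⟩ := h.cover (i + 1) j (by omega) hlt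
  have := h.col _ hd _ hd' i (i + 1) j (by simp [Domino.mem_cells_iff]) hc
  subst this
  simp [Domino.mem_cells_iff] at hc

theorem lt_end_of_mem (h : TilesStrip μ ν D) {i j : ℕ} (hd : (⟨i, j, false⟩ : Domino) ∈ D) :
    j + 1 < stripEnd μ ν i := by
  have h0 := h.sub _ hd i (j + 1) (by simp [Domino.mem_cells_iff])
  rw [lt_stripEnd_iff]
  refine ⟨h0.2, ?_⟩
  rintro i rfl
  by_contra! hlt
  have := ν.rowLen_anti i (i + 1) (by omega)
  obtain ⟨d, hd', hc⟩ := h.cover i (j + 1) (by omega) (by omega)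
  have := h.col _ hd _ hd' (i + 1) i (j + 1) (by simp [Domino.mem_cells_iff]) hc
  subst this
  simp [Domino.mem_cells_iff] at hc

/-- The horizontal dominoes of a row are forced one after the other from the left: each starts where
the previous one ends. -/
theorem mem_of_even (h : TilesStrip μ ν D) {i : ℕ} (t : ℕ)
    (ht : stripStart μ ν i + 2 * t < stripEnd μ ν i) :
    (⟨i, stripStart μ ν i + 2 * t, false⟩ : Domino) ∈ D := by
  induction t with
  | zero =>
    rcases h.horizontal_of_mem (by omega) ht with h1 | ⟨j', hj, h1⟩
    · exact h1
    · have := h.start_le_of_mem h1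
      omega
  | succ t ih =>
    have ih := ih (by omega)
    rcases h.horizontal_of_mem (by omega) ht with h1 | ⟨j', hj, h1⟩
    · exact h1
    · have := h.col _ ih _ h1 i i j' (by simp [Domino.mem_cells_iff]; omega)
        (by simp [Domino.mem_cells_iff])
      simp at this
      omega

/-- A column of the strip belongs to a single domino, hence has at most two cells. The part of a row
not covered by vertical dominoes is filled by horizontal ones, hence has even length. -/
theorem isStrip (h : TilesStrip μ ν D) (hle : ∀ i, μ.rowLen i ≤ ν.rowLen i) : IsStrip μ ν := by
  have htwo : ∀ i, ν.rowLen (i + 2) ≤ μ.rowLen i := by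
    intro i
    by_contra! hlt
    have h1 := μ.rowLen_anti i (i + 1) (by omega)
    have h2 := μ.rowLen_anti i (i + 2) (by omega)
    have h3 := ν.rowLen_anti (i + 1) (i + 2) (by omega)
    have h4 := ν.rowLen_anti i (i + 2) (by omega)
    obtain ⟨d, hd, hc⟩ := h.cover i (μ.rowLen i) le_rfl (by omega)
    obtain ⟨d1, hd1, hc1⟩ := h.cover (i + 1) (μ.rowLen i) h1 (by omega)
    obtain ⟨d2, hd2, hc2⟩ := h.cover (i + 2) (μ.rowLen i) h2 (by omega)
    have e1 := h.col _ hd _ hd1 _ _ _ hc hc1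
    have e2 := h.col _ hd _ hd2 _ _ _ hc hc2
    subst e1 e2
    rw [Domino.mem_cells_iff] at hc hc1 hc2
    omega
  refine ⟨hle, htwo, fun i => ?_⟩
  have hse : stripStart μ ν i ≤ stripEnd μ ν i := by
    cases i with
    | zero => exact max_le (hle 0) (ν.rowLen_anti _ _ (by omega))
    | succ i =>
      exact max_le (le_min (hle _) (μ.rowLen_anti _ _ (by omega)))
        (le_min (ν.rowLen_anti _ _ (by omega)) (htwo i))
  by_contra hne
  -- With odd length, the last forced horizontal domino would reach beyond `stripEnd`.
  obtain ⟨t, ht⟩ : ∃ t, stripEnd μ ν i = stripStart μ ν i + 2 * t + 1 :=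
    ⟨(stripEnd μ ν i - stripStart μ ν i) / 2, by omega⟩
  have := h.lt_end_of_mem (h.mem_of_even (i := i) t (by omega))
  omega

theorem subset_stripTiles (h : TilesStrip μ ν D) : D ⊆ stripTiles μ ν := by
  rintro ⟨i, j, v⟩ hd
  rw [mem_stripTiles]
  cases v with
  | true =>
    have h1 := h.sub _ hd i j (by simp [Domino.mem_cells_iff])
    have h2 := h.sub _ hd (i + 1) j (by simp [Domino.mem_cells_iff])
    exact Or.inl ⟨rfl, h1.1, h2.2⟩
  | false =>
    have h1 := h.start_le_of_mem hd
    have h2 := h.lt_end_of_mem hd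
    refine Or.inr ⟨rfl, h1, h2, ?_⟩
    by_contra hne
    simp only at hne h1 h2
    obtain ⟨t, ht⟩ : ∃ t, j = stripStart μ ν i + 2 * t + 1 :=
      ⟨(j - stripStart μ ν i) / 2, by omega⟩
    have := h.col _ hd _ (h.mem_of_even (i := i) t (by omega)) i i j
      (by simp [Domino.mem_cells_iff]) (by simp [Domino.mem_cells_iff]; omega)
    simp at this
    omega

theorem card (h : TilesStrip μ ν D) (hle : μ ≤ ν) : μ.card + 2 * D.card = ν.card := by
  have hν : ν.cells = μ.cells ∪ D.biUnion Domino.cells := by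
    ext ⟨i, j⟩
    rw [mem_union, mem_biUnion]
    constructor
    · intro hc
      by_cases hm : (i, j) ∈ μ.cells
      · exact Or.inl hm
      · simp only [YoungDiagram.mem_cells, YoungDiagram.mem_iff_lt_rowLen, not_lt] at hm hc
        exact Or.inr (h.cover i j hm hc)
    · rintro (hc | ⟨d, hd, hc⟩)
      · exact hle hc
      · simp only [YoungDiagram.mem_cells, YoungDiagram.mem_iff_lt_rowLen]
        exact (h.sub d hd i j hc).2
  have hdisj : Disjoint μ.cells (D.biUnion Domino.cells) := by
    rw [disjoint_left]
    rintro ⟨i, j⟩ hc hc'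
    obtain ⟨d, hd, hc'⟩ := mem_biUnion.1 hc'
    simp only [YoungDiagram.mem_cells, YoungDiagram.mem_iff_lt_rowLen] at hc
    have := (h.sub d hd i j hc').1
    omega
  have hbi : (D.biUnion Domino.cells).card = D.card * 2 := by
    rw [card_biUnion, sum_const_nat fun d _ => d.card_cells]
    intro d hd d' hd' hne
    rw [Function.onFun, disjoint_left]
    rintro ⟨i, j⟩ hc hc'
    exact hne (h.col d hd d' hd' i i j hc hc')
  rw [YoungDiagram.card, YoungDiagram.card, hν, card_union_of_disjoint hdisj, hbi, mul_comm]

end TilesStrip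

/-- The numerical conditions suffice: columns with two cells receive vertical dominoes, and the
remaining segment of each row, of even length, is cut into horizontal ones. -/
theorem IsStrip.tilesStrip {μ ν : YoungDiagram} (h : IsStrip μ ν) :
    TilesStrip μ ν (stripTiles μ ν) where
  sub := by
    rintro ⟨r, c, v⟩ hd i j hc
    rw [mem_stripTiles] at hd
    rw [Domino.mem_cells_iff] at hc
    have h1 := μ.rowLen_anti r (r + 1) (by omega)
    have h2 := ν.rowLen_anti r (r + 1) (by omega)
    have h3 := stripEnd_le μ ν r
    cases v with
    | true =>
      simp only [true_and, Bool.true_eq_false, false_and, or_false] at hd hc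
      rcases hc with ⟨rfl, rfl⟩ | ⟨rfl, rfl⟩ <;> omega
    | false =>
      simp only [Bool.false_eq_true, false_and, true_and, false_or, stripStart_le_iff] at hd hc
      rcases hc with ⟨rfl, rfl⟩ | ⟨rfl, rfl⟩ <;> omega
  cover := by
    intro i j h1 h2
    by_cases hs : j < ν.rowLen (i + 1)
    · exact ⟨⟨i, j, true⟩, mem_stripTiles.2 (Or.inl ⟨rfl, h1, hs⟩), by simp [Domino.mem_cells_iff]⟩
    · by_cases he : ∃ i', i = i' + 1 ∧ μ.rowLen i' ≤ j
      · obtain ⟨i', rfl, hi⟩ := he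
        exact ⟨⟨i', j, true⟩, mem_stripTiles.2 (Or.inl ⟨rfl, hi, h2⟩),
          by simp [Domino.mem_cells_iff]⟩
      · push Not at he hs
        have hst : stripStart μ ν i ≤ j := stripStart_le_iff.2 ⟨h1, hs⟩
        have hen : j < stripEnd μ ν i := lt_stripEnd_iff.2 ⟨h2, he⟩
        have hp := h.parity i
        rcases Nat.mod_two_eq_zero_or_one (j - stripStart μ ν i) with h0 | h0
        · exact ⟨⟨i, j, false⟩, mem_stripTiles.2 (Or.inr ⟨rfl, hst, by simp only; omega, h0⟩),
            by simp [Domino.mem_cells_iff]⟩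
        · exact ⟨⟨i, j - 1, false⟩, mem_stripTiles.2 (Or.inr
            ⟨rfl, by simp only; omega, by simp only; omega, by simp only; omega⟩),
            by simp [Domino.mem_cells_iff]; omega⟩
  col := by
    -- The claim is symmetric in the two dominoes, so the cell of the first may be assumed to be
    -- weakly above that of the second.
    have key : ∀ r c v r' c' v', (⟨r, c, v⟩ : Domino) ∈ stripTiles μ ν →
        (⟨r', c', v'⟩ : Domino) ∈ stripTiles μ ν → ∀ i i' j, i ≤ i' →
        (i, j) ∈ (⟨r, c, v⟩ : Domino).cells → (i', j) ∈ (⟨r', c', v'⟩ : Domino).cells →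
        (⟨r, c, v⟩ : Domino) = ⟨r', c', v'⟩ := by
      intro r c v r' c' v' hd hd' i i' j hi hc hc'
      rw [mem_stripTiles] at hd hd'
      rw [Domino.mem_cells_iff] at hc hc'
      have a1 : r + 2 ≤ r' → ν.rowLen r' ≤ μ.rowLen r := fun hr =>
        (ν.rowLen_anti _ _ hr).trans (h.two r)
      have a2 : r + 1 ≤ r' → ν.rowLen (r' + 1) ≤ μ.rowLen r := fun hr =>
        (ν.rowLen_anti _ _ (by omega)).trans (h.two r)
      have a3 : r + 1 ≤ r' → ν.rowLen r' ≤ ν.rowLen (r + 1) := fun hr => ν.rowLen_anti _ _ hr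
      have a4 : r + 1 ≤ r' → stripEnd μ ν r' ≤ μ.rowLen r := by
        intro hr
        obtain ⟨s, rfl⟩ : ∃ s, r' = s + 1 := ⟨r' - 1, by omega⟩
        exact (min_le_right _ _).trans (μ.rowLen_anti _ _ (by omega))
      have a5 := stripEnd_le μ ν r'
      have a6 := ν.rowLen_anti r' (r' + 1) (by omega)
      have a7 := stripEnd_le μ ν r
      have b1 : r' + 2 ≤ r → ν.rowLen r ≤ μ.rowLen r' := fun hr =>
        (ν.rowLen_anti _ _ hr).trans (h.two r')
      have b2 : r' + 1 ≤ r → ν.rowLen (r + 1) ≤ μ.rowLen r' := fun hr =>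
        (ν.rowLen_anti _ _ (by omega)).trans (h.two r')
      have b3 : r' + 1 ≤ r → ν.rowLen r ≤ ν.rowLen (r' + 1) := fun hr => ν.rowLen_anti _ _ hr
      have b4 : r' + 1 ≤ r → stripEnd μ ν r ≤ μ.rowLen r' := by
        intro hr
        obtain ⟨s, rfl⟩ : ∃ s, r = s + 1 := ⟨r - 1, by omega⟩
        exact (min_le_right _ _).trans (μ.rowLen_anti _ _ (by omega))
      rcases lt_trichotomy r r' with hr | rfl | hr
      · exfalso
        clear b1 b2 b3 b4
        cases v <;> cases v' <;>
          simp only [true_and, Bool.true_eq_false, false_and, or_false, Bool.false_eq_true,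
            false_or, stripStart_le_iff] at hd hd' hc hc' <;> omega
      · clear a1 a2 a3 a4 b1 b2 b3 b4
        have b1 := (stripStart_le_iff (μ := μ) (ν := ν) (i := r)).1 le_rfl
        cases v <;> cases v' <;>
          simp only [true_and, Bool.true_eq_false, false_and, or_false, Bool.false_eq_true,
            false_or] at hd hd' hc hc' <;>
          simp only [Domino.mk.injEq, true_and, and_true, Bool.true_eq_false, Bool.false_eq_true,
            and_false] <;> omega
      · exfalso
        clear a1 a2 a3 a4
        cases v <;> cases v' <;>
          simp only [true_and, Bool.true_eq_false, false_and, or_false, Bool.false_eq_true,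
            false_or, stripStart_le_iff] at hd hd' hc hc' <;> omega
    rintro ⟨r, c, v⟩ hd ⟨r', c', v'⟩ hd' i i' j hc hc'
    rcases le_total i i' with hi | hi
    · exact key r c v r' c' v' hd hd' i i' j hi hc hc'
    · exact (key r' c' v' r c v hd' hd i' i j hi hc' hc).symm

/-- Every tiling is contained in the standard one, and two tilings of the same region, one contained
in the other, coincide. -/
theorem TilesStrip.eq_stripTiles {μ ν : YoungDiagram} {D : Finset Domino} (h : TilesStrip μ ν D)
    (hle : ∀ i, μ.rowLen i ≤ ν.rowLen i) : D = stripTiles μ ν := by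
  refine Subset.antisymm h.subset_stripTiles fun d hd => ?_
  have hs := (h.isStrip hle).tilesStrip
  have hc : (d.row, d.col) ∈ d.cells := by simp [Domino.cells]
  have h0 := hs.sub d hd _ _ hc
  obtain ⟨d', hd', hc'⟩ := h.cover _ _ h0.1 h0.2
  rwa [hs.col _ hd _ (h.subset_stripTiles hd') _ _ _ hc hc']

/-! ### Tableaux as finite sets of labelled dominoes -/

/-- `L` is the set of labelled dominoes of a semistandard domino tableau of shape `μ`. -/
structure IsLabelled (μ : YoungDiagram) (L : Finset (Domino × ℕ)) : Prop where
  sub : ∀ x ∈ L, ∀ c ∈ x.1.cells, c ∈ μ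
  cover : ∀ c ∈ μ, ∃ x ∈ L, c ∈ x.1.cells
  uniq : ∀ x ∈ L, ∀ y ∈ L, ∀ c, c ∈ x.1.cells → c ∈ y.1.cells → x = y
  row : ∀ x ∈ L, ∀ y ∈ L, ∀ i j j', (i, j) ∈ x.1.cells → (i, j') ∈ y.1.cells → j < j' → x.2 ≤ y.2
  col : ∀ x ∈ L, ∀ y ∈ L, ∀ i i' j, x ≠ y → (i, j) ∈ x.1.cells → (i', j) ∈ y.1.cells → i < i' →
    x.2 < y.2
  corner : ∀ x ∈ L, (0, 0) ∈ x.1.cells → x.1.vertical = true → x.2 ≠ 0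

/-- The exponent of the monomial of a set of labelled dominoes. -/
noncomputable def labelWeight (L : Finset (Domino × ℕ)) : ℕ →₀ ℕ :=
  ∑ x ∈ L, Finsupp.single x.2 1

/-- The tableaux of shape `μ` and weight `m`, as sets of labelled dominoes. -/
def tabSet (μ : YoungDiagram) (m : ℕ →₀ ℕ) : Set (Finset (Domino × ℕ)) :=
  {L | IsLabelled μ L ∧ labelWeight L = m}

/-- The number of semistandard domino tableaux of shape `μ` and weight `m`. -/
noncomputable def tabCount (μ : YoungDiagram) (m : ℕ →₀ ℕ) : ℕ :=
  Nat.card (tabSet μ m)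

theorem Domino.corner_mem (d : Domino) : (d.row, d.col) ∈ d.cells := by
  simp [Domino.cells]

theorem labelWeight_ne_zero {L : Finset (Domino × ℕ)} {x : Domino × ℕ} (hx : x ∈ L) :
    labelWeight L x.2 ≠ 0 := by
  rw [labelWeight, Finsupp.finsetSum_apply]
  have := single_le_sum (f := fun y : Domino × ℕ => (Finsupp.single y.2 1 : ℕ →₀ ℕ) x.2)
    (fun _ _ => Nat.zero_le _) hx
  simp only [Finsupp.single_eq_same] at this
  omega

instance tabSet_finite (μ : YoungDiagram) (m : ℕ →₀ ℕ) : Finite (tabSet μ m) := by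
  refine Set.Finite.subset (μ.dominoes ×ˢ m.support).powerset.finite_toSet ?_
  rintro L ⟨hL, rfl⟩
  rw [mem_coe, mem_powerset]
  intro x hx
  rw [mem_product, YoungDiagram.mem_dominoes, ← YoungDiagram.mem_iff_lt_rowLen,
    Finsupp.mem_support_iff]
  exact ⟨hL.sub x hx _ x.1.corner_mem, labelWeight_ne_zero hx⟩

/-- The labelled dominoes of a tableau. -/
def SSDT.labelled {μ : YoungDiagram} (T : SSDT μ) : Finset (Domino × ℕ) :=
  T.tiles.attach.image fun d => (d.1, T.label d)

theorem SSDT.mem_labelled {μ : YoungDiagram} (T : SSDT μ) {x : Domino × ℕ} :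
    x ∈ T.labelled ↔ ∃ h : x.1 ∈ T.tiles, T.label ⟨x.1, h⟩ = x.2 := by
  rw [SSDT.labelled, mem_image]
  constructor
  · rintro ⟨d, -, rfl⟩
    exact ⟨d.2, rfl⟩
  · rintro ⟨h, hx⟩
    exact ⟨⟨x.1, h⟩, mem_attach _ _, Prod.ext rfl hx⟩

theorem SSDT.labelled_injective {μ : YoungDiagram} :
    Function.Injective (SSDT.labelled : SSDT μ → _) := by
  intro T T' h
  have key : ∀ T T' : SSDT μ, T.labelled = T'.labelled → T.tiles ⊆ T'.tiles := by
    intro T T' h d hd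
    have : (d, T.label ⟨d, hd⟩) ∈ T'.labelled := h ▸ T.mem_labelled.2 ⟨hd, rfl⟩
    exact (T'.mem_labelled.1 this).1
  have ht : T.tiles = T'.tiles := Subset.antisymm (key T T' h) (key T' T h.symm)
  have hl : ∀ d (hd : d ∈ T.tiles) (hd' : d ∈ T'.tiles), T.label ⟨d, hd⟩ = T'.label ⟨d, hd'⟩ := by
    intro d hd hd'
    have : (d, T.label ⟨d, hd⟩) ∈ T'.labelled := h ▸ T.mem_labelled.2 ⟨hd, rfl⟩
    exact (T'.mem_labelled.1 this).2.symm
  cases T with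
  | mk t1 _ l1 _ _ _ =>
    cases T' with
    | mk t2 _ l2 _ _ _ =>
      simp only at ht hl
      subst ht
      obtain rfl : l1 = l2 := funext fun d => hl d.1 d.2 d.2
      rfl

theorem SSDT.exists_of_mem_labelled {μ : YoungDiagram} (T : SSDT μ) {x : Domino × ℕ}
    (hx : x ∈ T.labelled) : ∃ d : T.tiles, x = (d.1, T.label d) := by
  obtain ⟨h, hl⟩ := T.mem_labelled.1 hx
  exact ⟨⟨x.1, h⟩, Prod.ext rfl hl.symm⟩

theorem SSDT.isLabelled {μ : YoungDiagram} (T : SSDT μ) : IsLabelled μ T.labelled where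
  sub := by
    intro x hx c hc
    exact T.isTiling.1 _ (T.mem_labelled.1 hx).1 hc
  cover := by
    intro c hc
    obtain ⟨d, ⟨hd, hc⟩, -⟩ := T.isTiling.2 c hc
    exact ⟨(d, T.label ⟨d, hd⟩), T.mem_labelled.2 ⟨hd, rfl⟩, hc⟩
  uniq := by
    intro x hx y hy c hc hc'
    obtain ⟨d, rfl⟩ := T.exists_of_mem_labelled hx
    obtain ⟨d', rfl⟩ := T.exists_of_mem_labelled hy
    rw [Subtype.ext ((T.isTiling.2 c (T.isTiling.1 _ d.2 hc)).unique ⟨d.2, hc⟩ ⟨d'.2, hc'⟩)]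
  row := by
    intro x hx y hy i j j' hc hc' hj
    obtain ⟨d, rfl⟩ := T.exists_of_mem_labelled hx
    obtain ⟨d', rfl⟩ := T.exists_of_mem_labelled hy
    exact T.row_weak d d' i j j' hc hc' hj
  col := by
    intro x hx y hy i i' j hne hc hc' hi
    obtain ⟨d, rfl⟩ := T.exists_of_mem_labelled hx
    obtain ⟨d', rfl⟩ := T.exists_of_mem_labelled hy
    exact T.col_strict d d' i i' j (fun h => hne (by rw [h])) hc hc' hi
  corner := by
    intro x hx hc hv
    obtain ⟨d, rfl⟩ := T.exists_of_mem_labelled hx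
    exact T.corner d hc hv

theorem SSDT.labelWeight_labelled {μ : YoungDiagram} (T : SSDT μ) :
    labelWeight T.labelled = T.weight := by
  rw [labelWeight, SSDT.labelled, sum_image, SSDT.weight]
  · rfl
  · intro d _ d' _ h
    exact Subtype.ext (congrArg Prod.fst h)

/-- With injectivity of `SSDT.labelled`, this lets tableaux be counted as plain finite sets, free of
the dependent type of the label function. -/
theorem IsLabelled.exists_ssdt {μ : YoungDiagram} {L : Finset (Domino × ℕ)} (h : IsLabelled μ L) :
    ∃ T : SSDT μ, T.labelled = L := by
  have hl : ∀ d : L.image Prod.fst, ∃ l, (d.1, l) ∈ L := by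
    rintro ⟨d, hd⟩
    obtain ⟨x, hx, rfl⟩ := mem_image.1 hd
    exact ⟨x.2, hx⟩
  choose lab hlab using hl
  refine ⟨⟨L.image Prod.fst, ⟨?_, ?_⟩, lab, ?_, ?_, ?_⟩, ?_⟩
  · intro d hd c hc
    obtain ⟨x, hx, rfl⟩ := mem_image.1 hd
    exact h.sub x hx c hc
  · intro c hc
    obtain ⟨x, hx, hxc⟩ := h.cover c hc
    refine ⟨x.1, ⟨mem_image_of_mem _ hx, hxc⟩, ?_⟩
    rintro d ⟨hd, hdc⟩
    obtain ⟨y, hy, rfl⟩ := mem_image.1 hd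
    rw [h.uniq x hx y hy c hxc hdc]
  · intro d d' i j j' hc hc' hj
    exact h.row _ (hlab d) _ (hlab d') i j j' hc hc' hj
  · intro d d' i i' j hne hc hc' hi
    exact h.col _ (hlab d) _ (hlab d') i i' j (fun e => hne (Subtype.ext (congrArg Prod.fst e)))
      hc hc' hi
  · intro d hc hv
    exact h.corner _ (hlab d) hc hv
  · ext x
    rw [SSDT.mem_labelled]
    constructor
    · rintro ⟨hx, he⟩
      have := hlab ⟨x.1, hx⟩
      simp only at he
      rwa [he] at this
    · intro hx
      refine ⟨mem_image_of_mem _ hx, ?_⟩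
      exact congrArg Prod.snd (h.uniq _ (hlab ⟨x.1, mem_image_of_mem _ hx⟩) _ hx _
        x.1.corner_mem x.1.corner_mem)

theorem dominoFun_apply (μ : YoungDiagram) (m : ℕ →₀ ℕ) : dominoFun μ m = (tabCount μ m : ℂ) := by
  rw [dominoFun, tabCount]
  congr 1
  refine Nat.card_eq_of_bijective
    (fun T : {T : SSDT μ // T.weight = m} =>
      (⟨T.1.labelled, T.1.isLabelled, T.1.labelWeight_labelled.trans T.2⟩ : tabSet μ m)) ⟨?_, ?_⟩
  · intro T T' h
    exact Subtype.ext (SSDT.labelled_injective (congrArg Subtype.val h))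
  · rintro ⟨L, hL, hm⟩
    obtain ⟨T, rfl⟩ := hL.exists_ssdt
    exact ⟨⟨T, T.labelWeight_labelled.symm.trans hm⟩, rfl⟩

theorem IsLabelled.cells_eq {μ : YoungDiagram} {L : Finset (Domino × ℕ)} (h : IsLabelled μ L) :
    μ.cells = L.biUnion fun x => x.1.cells := by
  ext c
  rw [mem_biUnion]
  exact ⟨h.cover c, fun ⟨x, hx, hc⟩ => h.sub x hx c hc⟩

theorem labelWeight_degree {μ : YoungDiagram} {L : Finset (Domino × ℕ)} (h : IsLabelled μ L) :
    2 * (labelWeight L).degree = μ.card := by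
  have h1 : (labelWeight L).degree = L.card := by
    simp [labelWeight, map_sum, Finsupp.degree_single]
  rw [h1, YoungDiagram.card, h.cells_eq, card_biUnion, sum_const_nat fun x _ => x.1.card_cells,
    mul_comm]
  intro x hx y hy hne
  rw [Function.onFun, disjoint_left]
  exact fun c hc hc' => hne (h.uniq x hx y hy c hc hc')

theorem tabCount_eq_zero {μ : YoungDiagram} {m : ℕ →₀ ℕ} (h : 2 * m.degree ≠ μ.card) :
    tabCount μ m = 0 := by
  rw [tabCount, Nat.card_eq_zero]
  refine Or.inl ⟨?_⟩
  rintro ⟨L, hL, rfl⟩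
  exact h (labelWeight_degree hL)

/-! ### Removing the dominoes with the largest label -/

/-- Condition for a strip of dominoes labelled `k` to be added to a tableau of shape `μ`. -/
def StripStep (k d : ℕ) (μ ν : YoungDiagram) : Prop :=
  IsStrip μ ν ∧ μ.card + 2 * d = ν.card ∧ (k = 0 → μ.rowLen 0 = 0 → ν.rowLen 1 = 0)

/-- Add the dominoes of the strip `ν / μ` with label `k`. -/
def addStrip (k : ℕ) (μ ν : YoungDiagram) (L : Finset (Domino × ℕ)) : Finset (Domino × ℕ) :=
  L ∪ (stripTiles μ ν).image fun d => (d, k)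

theorem mem_addStrip {k : ℕ} {μ ν : YoungDiagram} {L : Finset (Domino × ℕ)} {x : Domino × ℕ} :
    x ∈ addStrip k μ ν L ↔ x ∈ L ∨ x.1 ∈ stripTiles μ ν ∧ x.2 = k := by
  rw [addStrip, mem_union, mem_image]
  refine or_congr_right ⟨?_, fun h => ⟨x.1, h.1, Prod.ext rfl h.2.symm⟩⟩
  rintro ⟨d, hd, rfl⟩
  exact ⟨hd, rfl⟩

theorem IsStrip.mono {μ ν : YoungDiagram} (h : IsStrip μ ν) : μ ≤ ν := by
  rintro ⟨i, j⟩ hc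
  exact YoungDiagram.mem_iff_lt_rowLen.2 ((YoungDiagram.mem_iff_lt_rowLen.1 hc).trans_le (h.le i))

theorem rowLen_mono {μ ν : YoungDiagram} (h : μ ≤ ν) (i : ℕ) : μ.rowLen i ≤ ν.rowLen i := by
  by_contra! hlt
  exact lt_irrefl _ (YoungDiagram.mem_iff_lt_rowLen.1 (h (YoungDiagram.mem_iff_lt_rowLen.2 hlt)))

theorem isLabelled_addStrip {k : ℕ} {μ ν : YoungDiagram} {L : Finset (Domino × ℕ)}
    (h : IsLabelled μ L) (hk : ∀ x ∈ L, x.2 < k) (hs : IsStrip μ ν)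
    (h0 : k = 0 → μ.rowLen 0 = 0 → ν.rowLen 1 = 0) : IsLabelled ν (addStrip k μ ν L) := by
  have ht := hs.tilesStrip
  have hsk : ∀ d ∈ stripTiles μ ν, ∀ i j, (i, j) ∈ d.cells → (i, j) ∉ μ := by
    intro d hd i j hc hm
    have := (ht.sub d hd i j hc).1
    rw [YoungDiagram.mem_iff_lt_rowLen] at hm
    omega
  refine ⟨?_, ?_, ?_, ?_, ?_, ?_⟩
  · rintro x hx ⟨i, j⟩ hc
    rcases mem_addStrip.1 hx with hx | ⟨hx, -⟩
    · exact hs.mono (h.sub x hx _ hc)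
    · exact YoungDiagram.mem_iff_lt_rowLen.2 (ht.sub _ hx i j hc).2
  · rintro ⟨i, j⟩ hc
    by_cases hm : (i, j) ∈ μ
    · obtain ⟨x, hx, hxc⟩ := h.cover _ hm
      exact ⟨x, mem_addStrip.2 (Or.inl hx), hxc⟩
    · rw [YoungDiagram.mem_iff_lt_rowLen] at hc hm
      obtain ⟨d, hd, hdc⟩ := ht.cover i j (by omega) hc
      exact ⟨(d, k), mem_addStrip.2 (Or.inr ⟨hd, rfl⟩), hdc⟩
  · rintro x hx y hy ⟨i, j⟩ hc hc'
    rcases mem_addStrip.1 hx with hx | ⟨hx, hxk⟩ <;> rcases mem_addStrip.1 hy with hy | ⟨hy, hyk⟩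
    · exact h.uniq x hx y hy _ hc hc'
    · exact absurd (h.sub x hx _ hc) (hsk _ hy _ _ hc')
    · exact absurd (h.sub y hy _ hc') (hsk _ hx _ _ hc)
    · exact Prod.ext (ht.col _ hx _ hy _ _ _ hc hc') (hxk.trans hyk.symm)
  · rintro x hx y hy i j j' hc hc' hj
    rcases mem_addStrip.1 hx with hx | ⟨hx, hxk⟩ <;> rcases mem_addStrip.1 hy with hy | ⟨hy, hyk⟩
    · exact h.row x hx y hy _ _ _ hc hc' hj
    · exact hyk ▸ (hk x hx).le
    · exact absurd (μ.up_left_mem le_rfl hj.le (h.sub y hy _ hc')) (hsk _ hx _ _ hc)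
    · exact (hxk.trans hyk.symm).le
  · rintro x hx y hy i i' j hne hc hc' hi
    rcases mem_addStrip.1 hx with hx | ⟨hx, hxk⟩ <;> rcases mem_addStrip.1 hy with hy | ⟨hy, hyk⟩
    · exact h.col x hx y hy _ _ _ hne hc hc' hi
    · exact hyk ▸ hk x hx
    · exact absurd (μ.up_left_mem hi.le le_rfl (h.sub y hy _ hc')) (hsk _ hx _ _ hc)
    · exact absurd (Prod.ext (ht.col _ hx _ hy _ _ _ hc hc') (hxk.trans hyk.symm)) hne
  · rintro x hx hc hv
    rcases mem_addStrip.1 hx with hx | ⟨hx, hxk⟩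
    · exact h.corner x hx hc hv
    · rintro hx0
      have h1 := (ht.sub _ hx 0 0 hc).1
      -- A vertical domino with label 0 on the corner would make `μ` empty and put the cell (1, 0)
      -- into `ν`, against `h0`.
      have h2 : x.1.row = 0 ∧ x.1.col = 0 := by
        rw [Domino.mem_cells_iff] at hc
        simp only [hv] at hc
        simp at hc
        omega
      have h3 := (ht.sub _ hx 1 0 (Domino.mem_cells_iff.2 (by simp [hv, h2]))).2
      have := h0 (hxk.symm.trans hx0) (by omega)
      omega

theorem labelWeight_addStrip {k : ℕ} {μ ν : YoungDiagram} {L : Finset (Domino × ℕ)}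
    (hk : ∀ x ∈ L, x.2 < k) :
    labelWeight (addStrip k μ ν L) = labelWeight L + Finsupp.single k (stripTiles μ ν).card := by
  rw [labelWeight, addStrip, sum_union, sum_image]
  · simp [labelWeight]
  · intro d _ d' _ h
    exact congrArg Prod.fst h
  · rw [disjoint_left]
    intro x hx hx'
    obtain ⟨d, -, rfl⟩ := mem_image.1 hx'
    exact lt_irrefl _ (hk _ hx)

/-- The smaller tableau is recovered from the larger one by discarding the label `k`. -/
theorem filter_addStrip {k : ℕ} {μ ν : YoungDiagram} {L : Finset (Domino × ℕ)}
    (hk : ∀ x ∈ L, x.2 < k) : (addStrip k μ ν L).filter (fun x => x.2 < k) = L := by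
  ext x
  rw [mem_filter, mem_addStrip]
  constructor
  · rintro ⟨hx | ⟨-, rfl⟩, hlt⟩
    · exact hx
    · exact absurd hlt (lt_irrefl _)
  · exact fun hx => ⟨Or.inl hx, hk x hx⟩

/-- Labels weakly increase to the right and downwards, so the cells with small labels form a lower
set. -/
theorem IsLabelled.exists_below {ν : YoungDiagram} {L : Finset (Domino × ℕ)} (h : IsLabelled ν L)
    (k : ℕ) : ∃ μ : YoungDiagram, ∀ c, c ∈ μ ↔ ∃ x ∈ L, x.2 < k ∧ c ∈ x.1.cells := by
  refine ⟨⟨(L.filter fun x => x.2 < k).biUnion fun x => x.1.cells, ?_⟩, ?_⟩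
  · rintro ⟨i, j⟩ ⟨i', j'⟩ hle hc
    rw [mem_coe, mem_biUnion] at hc ⊢
    obtain ⟨x, hx, hxc⟩ := hc
    rw [mem_filter] at hx
    obtain ⟨hi, hj⟩ := Prod.mk_le_mk.1 hle
    have hν := h.sub x hx.1 _ hxc
    obtain ⟨z, hz, hzc⟩ := h.cover (i, j') (ν.up_left_mem le_rfl hj hν)
    -- The comparison goes through the corner (i, j'): along row i first, then down column j'.
    obtain ⟨y, hy, hyc⟩ := h.cover (i', j') (ν.up_left_mem hi hj hν)
    have h1 : z.2 ≤ x.2 := by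
      rcases hj.lt_or_eq with hj | rfl
      · exact h.row z hz x hx.1 _ _ _ hzc hxc hj
      · rw [h.uniq z hz x hx.1 _ hzc hxc]
    have h2 : y.2 ≤ z.2 := by
      by_cases hyz : y = z
      · rw [hyz]
      rcases hi.lt_or_eq with hi | rfl
      · exact (h.col y hy z hz _ _ _ hyz hyc hzc hi).le
      · rw [h.uniq y hy z hz _ hyc hzc]
    exact ⟨y, mem_filter.2 ⟨hy, h2.trans_lt (h1.trans_lt hx.2)⟩, hyc⟩
  · intro c
    exact mem_biUnion.trans (by simp only [mem_filter, and_assoc])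

/-- Strictness down the columns means that two different dominoes with label `k` never share a
column; they thus tile a strip over the shape of the smaller labels, and such a tiling is unique. -/
theorem IsLabelled.exists_eq_addStrip {ν : YoungDiagram} {L : Finset (Domino × ℕ)}
    (h : IsLabelled ν L) {k : ℕ} (hk : ∀ x ∈ L, x.2 ≤ k) :
    ∃ μ L', IsLabelled μ L' ∧ (∀ x ∈ L', x.2 < k) ∧ IsStrip μ ν ∧
      (k = 0 → μ.rowLen 0 = 0 → ν.rowLen 1 = 0) ∧ L = addStrip k μ ν L' := by
  obtain ⟨μ, hμ⟩ := h.exists_below k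
  have hsub : μ ≤ ν := by
    intro c hc
    obtain ⟨x, hx, -, hxc⟩ := (hμ c).1 hc
    exact h.sub x hx c hxc
  have hnot : ∀ x ∈ L, x.2 = k → ∀ c ∈ x.1.cells, c ∉ μ := by
    intro x hx hxk c hc hcμ
    obtain ⟨y, hy, hyk, hyc⟩ := (hμ c).1 hcμ
    rw [h.uniq x hx y hy c hc hyc] at hxk
    omega
  have hD : TilesStrip μ ν ((L.filter fun x => x.2 = k).image Prod.fst) := by
    refine ⟨?_, ?_, ?_⟩
    · intro d hd i j hc
      obtain ⟨x, hx, rfl⟩ := mem_image.1 hd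
      rw [mem_filter] at hx
      have h1 := hnot x hx.1 hx.2 _ hc
      have h2 := h.sub x hx.1 _ hc
      rw [YoungDiagram.mem_iff_lt_rowLen] at h1 h2
      exact ⟨not_lt.1 h1, h2⟩
    · intro i j h1 h2
      obtain ⟨x, hx, hxc⟩ := h.cover (i, j) (YoungDiagram.mem_iff_lt_rowLen.2 h2)
      refine ⟨x.1, mem_image_of_mem _ (mem_filter.2 ⟨hx, ?_⟩), hxc⟩
      by_contra hne
      have : (i, j) ∈ μ := (hμ _).2 ⟨x, hx, lt_of_le_of_ne (hk x hx) hne, hxc⟩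
      rw [YoungDiagram.mem_iff_lt_rowLen] at this
      omega
    · intro d hd d' hd' i i' j hc hc'
      obtain ⟨x, hx, rfl⟩ := mem_image.1 hd
      obtain ⟨y, hy, rfl⟩ := mem_image.1 hd'
      rw [mem_filter] at hx hy
      by_contra hne
      have hne' : x ≠ y := fun e => hne (by rw [e])
      rcases lt_trichotomy i i' with hi | rfl | hi
      · have := h.col x hx.1 y hy.1 _ _ _ hne' hc hc' hi
        omega
      · exact hne' (h.uniq x hx.1 y hy.1 _ hc hc')
      · have := h.col y hy.1 x hx.1 _ _ _ hne'.symm hc' hc hi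
        omega
  have hs := hD.isStrip (rowLen_mono hsub)
  have he := hD.eq_stripTiles (rowLen_mono hsub)
  refine ⟨μ, L.filter fun x => x.2 < k, ⟨?_, ?_, ?_, ?_, ?_, ?_⟩, ?_, hs, ?_, ?_⟩
  · intro x hx c hc
    rw [mem_filter] at hx
    exact (hμ c).2 ⟨x, hx.1, hx.2, hc⟩
  · intro c hc
    obtain ⟨x, hx, hxk, hxc⟩ := (hμ c).1 hc
    exact ⟨x, mem_filter.2 ⟨hx, hxk⟩, hxc⟩
  · exact fun x hx y hy => h.uniq x (mem_filter.1 hx).1 y (mem_filter.1 hy).1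
  · exact fun x hx y hy => h.row x (mem_filter.1 hx).1 y (mem_filter.1 hy).1
  · exact fun x hx y hy => h.col x (mem_filter.1 hx).1 y (mem_filter.1 hy).1
  · exact fun x hx => h.corner x (mem_filter.1 hx).1
  · exact fun x hx => (mem_filter.1 hx).2
  · intro hk0 hμ0
    by_contra hν
    -- Over the empty shape, a second row of `ν` forces a vertical domino in the corner.
    have hv : (⟨0, 0, true⟩ : Domino) ∈ stripTiles μ ν :=
      mem_stripTiles.2 (Or.inl ⟨rfl, hμ0.le, Nat.pos_of_ne_zero hν⟩)
    rw [← he] at hv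
    obtain ⟨x, hx, hxd⟩ := mem_image.1 hv
    rw [mem_filter] at hx
    exact h.corner x hx.1 (hxd ▸ by simp [Domino.cells]) (by rw [hxd]) (hx.2.trans hk0)
  · ext x
    rw [mem_addStrip, mem_filter, ← he, mem_image]
    constructor
    · intro hx
      rcases (hk x hx).lt_or_eq with hlt | heq
      · exact Or.inl ⟨hx, hlt⟩
      · exact Or.inr ⟨⟨x, mem_filter.2 ⟨hx, heq⟩, rfl⟩, heq⟩
    · rintro (hx | ⟨⟨y, hy, hyx⟩, hxk⟩)
      · exact hx.1
      · rw [mem_filter] at hy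
        rw [← Prod.ext hyx (hy.2.trans hxk.symm)]
        exact hy.1

open Classical in
/-- Counting tableaux by the shape that remains when the largest label is removed. -/
theorem tabCount_add_single {ι : Type*} (ν : YoungDiagram) (m : ℕ →₀ ℕ) (k d : ℕ)
    (hm : ∀ i ∈ m.support, i < k) (F : Finset ι) (f : ι → YoungDiagram) (hf : Set.InjOn f F)
    (hF : ∀ μ, StripStep k d μ ν → ∃ x ∈ F, f x = μ) :
    tabCount ν (m + Finsupp.single k d) =
      ∑ x ∈ F, if StripStep k d (f x) ν then tabCount (f x) m else 0 := by
  have hlt : ∀ {L : Finset (Domino × ℕ)}, labelWeight L = m → ∀ x ∈ L, x.2 < k := by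
    intro L hL x hx
    exact hm _ (Finsupp.mem_support_iff.2 (hL ▸ labelWeight_ne_zero hx))
  have hcard : ∀ {μ : YoungDiagram}, IsStrip μ ν → μ.card + 2 * (stripTiles μ ν).card = ν.card :=
    fun hs => hs.tilesStrip.card hs.mono
  rw [← sum_filter, ← sum_coe_sort]
  simp only [tabCount]
  rw [← Nat.card_sigma]
  symm
  -- The strip is determined by the two shapes, so the larger tableau carries the same information
  -- as the smaller shape with its tableau.
  refine Nat.card_eq_of_bijective
    (fun p : Σ x : (F.filter fun x => StripStep k d (f x) ν), tabSet (f x) m =>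
      (⟨addStrip k (f p.1) ν p.2.1, ?_, ?_⟩ : tabSet ν (m + Finsupp.single k d))) ⟨?_, ?_⟩
  · have hp := (mem_filter.1 p.1.2).2
    exact isLabelled_addStrip p.2.2.1 (hlt p.2.2.2) hp.1 hp.2.2
  · have hp := (mem_filter.1 p.1.2).2
    rw [labelWeight_addStrip (hlt p.2.2.2), p.2.2.2]
    have h1 := hcard hp.1
    have h2 := hp.2.1
    congr 2
    omega
  · rintro ⟨⟨x, hx⟩, L, hL⟩ ⟨⟨y, hy⟩, L', hL'⟩ h
    have h := congrArg Subtype.val h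
    simp only at h hL hL'
    have hLL : L = L' := by
      rw [← filter_addStrip (μ := f x) (ν := ν) (hlt hL.2), h, filter_addStrip (hlt hL'.2)]
    subst hLL
    have hxy : f x = f y := YoungDiagram.ext (hL.1.cells_eq.trans hL'.1.cells_eq.symm)
    obtain rfl : x = y := hf (mem_filter.1 hx).1 (mem_filter.1 hy).1 hxy
    rfl
  · rintro ⟨L, hL, hw⟩
    have hk : ∀ x ∈ L, x.2 ≤ k := by
      intro x hx
      have := labelWeight_ne_zero hx
      rw [hw, Finsupp.add_apply] at this
      by_contra! hlt
      have h1 : m x.2 = 0 := by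
        by_contra hne
        have := hm _ (Finsupp.mem_support_iff.2 hne)
        omega
      rw [h1, Finsupp.single_apply, if_neg (by omega)] at this
      exact this rfl
    obtain ⟨μ, L', hL', hk', hs, h0, rfl⟩ := hL.exists_eq_addStrip hk
    rw [labelWeight_addStrip hk'] at hw
    have hkz : labelWeight L' k = 0 := by
      rw [labelWeight, Finsupp.finsetSum_apply]
      exact sum_eq_zero fun x hx => Finsupp.single_eq_of_ne (hk' x hx).ne'
    have hmz : m k = 0 := by
      by_contra hne
      exact lt_irrefl _ (hm k (Finsupp.mem_support_iff.2 hne))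
    have hd : (stripTiles μ ν).card = d := by
      have := DFunLike.congr_fun hw k
      simpa [hkz, hmz] using this
    rw [hd] at hw
    have hw' := add_right_cancel hw
    have hstep : StripStep k d μ ν := ⟨hs, by rw [← hd]; exact hcard hs, h0⟩
    obtain ⟨x, hx, rfl⟩ := hF μ hstep
    exact ⟨⟨⟨x, mem_filter.2 ⟨hx, hstep⟩⟩, L', hL', hw'⟩, rfl⟩

/-! ### Diagrams with at most four rows -/

theorem YoungDiagram.ext_rowLen {μ ν : YoungDiagram} (h : ∀ i, μ.rowLen i = ν.rowLen i) :
    μ = ν := by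
  refine YoungDiagram.ext (Finset.ext fun ⟨i, j⟩ => ?_)
  rw [YoungDiagram.mem_cells, YoungDiagram.mem_cells, YoungDiagram.mem_iff_lt_rowLen,
    YoungDiagram.mem_iff_lt_rowLen, h]

theorem mem_diagram {l : List ℕ} (h : l.SortedGE) {i j : ℕ} :
    (i, j) ∈ diagram l ↔ j < l.getD i 0 := by
  rw [diagram, dif_pos h, YoungDiagram.mem_ofRowLens]
  constructor
  · rintro ⟨h1, h2⟩
    simpa [List.getD_eq_getElem, h1] using h2
  · intro h2
    by_cases h1 : i < l.length
    · exact ⟨h1, by simpa [List.getD_eq_getElem, h1] using h2⟩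
    · rw [List.getD_eq_default _ _ (by omega)] at h2
      omega

theorem rowLen_diagram {l : List ℕ} (h : l.SortedGE) (i : ℕ) :
    (diagram l).rowLen i = l.getD i 0 := by
  refine eq_of_forall_lt_iff fun j => ?_
  rw [← YoungDiagram.mem_iff_lt_rowLen, mem_diagram h]

theorem diagram_append_zero {l : List ℕ} (h : (l ++ [0]).SortedGE) :
    diagram (l ++ [0]) = diagram l := by
  have h' : l.SortedGE := by
    rw [List.sortedGE_iff_pairwise] at h ⊢
    exact (List.pairwise_append.1 h).1
  refine YoungDiagram.ext_rowLen fun i => ?_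
  rw [rowLen_diagram h, rowLen_diagram h']
  rcases lt_trichotomy i l.length with hi | rfl | hi
  · rw [List.getD_append _ _ _ _ hi]
  · simp
  · rw [List.getD_eq_default _ _ (by simp; omega), List.getD_eq_default _ _ (by omega)]

theorem sortedGE_four {a b c e : ℕ} (h1 : b ≤ a) (h2 : c ≤ b) (h3 : e ≤ c) :
    [a, b, c, e].SortedGE := by
  rw [List.sortedGE_iff_pairwise]
  simp
  omega

theorem rowLen_diagram_four {a b c e : ℕ} (h1 : b ≤ a) (h2 : c ≤ b) (h3 : e ≤ c) :
    (diagram [a, b, c, e]).rowLen 0 = a ∧ (diagram [a, b, c, e]).rowLen 1 = b ∧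
    (diagram [a, b, c, e]).rowLen 2 = c ∧ (diagram [a, b, c, e]).rowLen 3 = e ∧
    ∀ i, (diagram [a, b, c, e]).rowLen (i + 4) = 0 := by
  have h := sortedGE_four h1 h2 h3
  refine ⟨?_, ?_, ?_, ?_, fun i => ?_⟩ <;> simp [rowLen_diagram h]

theorem card_eq_of_rowLen_four {μ : YoungDiagram} (h : μ.rowLen 4 = 0) :
    μ.card = μ.rowLen 0 + μ.rowLen 1 + μ.rowLen 2 + μ.rowLen 3 := by
  rw [YoungDiagram.card, card_eq_sum_card_fiberwise (f := Prod.fst) (t := range 4)]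
  · simp only [YoungDiagram.rowLen_eq_card, sum_range_succ, sum_range_zero, zero_add]
    rfl
  · rintro ⟨i, j⟩ hc
    rw [mem_coe, YoungDiagram.mem_cells, YoungDiagram.mem_iff_lt_rowLen] at hc
    rw [mem_coe, mem_range]
    by_contra! hi
    have := μ.rowLen_anti 4 i hi
    omega

theorem eq_diagram_four {μ : YoungDiagram} (h : μ.rowLen 4 = 0) :
    μ = diagram [μ.rowLen 0, μ.rowLen 1, μ.rowLen 2, μ.rowLen 3] := by
  obtain ⟨h0, h1, h2, h3, h4⟩ := rowLen_diagram_four (μ.rowLen_anti 0 1 (by omega))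
    (μ.rowLen_anti 1 2 (by omega)) (μ.rowLen_anti 2 3 (by omega))
  refine YoungDiagram.ext_rowLen fun i => ?_
  match i with
  | 0 => exact h0.symm
  | 1 => exact h1.symm
  | 2 => exact h2.symm
  | 3 => exact h3.symm
  | i + 4 =>
    rw [h4]
    have := μ.rowLen_anti 4 (i + 4) (by omega)
    omega

theorem diagram_four_injective {a b c e a' b' c' e' : ℕ} (h1 : b ≤ a) (h2 : c ≤ b) (h3 : e ≤ c)
    (h1' : b' ≤ a') (h2' : c' ≤ b') (h3' : e' ≤ c')
    (h : diagram [a, b, c, e] = diagram [a', b', c', e']) : a = a' ∧ b = b' ∧ c = c' ∧ e = e' := by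
  obtain ⟨p0, p1, p2, p3, -⟩ := rowLen_diagram_four h1 h2 h3
  obtain ⟨q0, q1, q2, q3, -⟩ := rowLen_diagram_four h1' h2' h3'
  rw [h] at p0 p1 p2 p3
  exact ⟨p0.symm.trans q0, p1.symm.trans q1, p2.symm.trans q2, p3.symm.trans q3⟩

/-- All conditions become linear arithmetic with parities in eight row lengths, which makes every
later statement about strips decidable by `omega`. -/
theorem stripStep_iff {k d : ℕ} {μ ν : YoungDiagram} (hμ : μ.rowLen 4 = 0) (hν : ν.rowLen 4 = 0) :
    StripStep k d μ ν ↔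
      (μ.rowLen 0 ≤ ν.rowLen 0 ∧ μ.rowLen 1 ≤ ν.rowLen 1 ∧ μ.rowLen 2 ≤ ν.rowLen 2 ∧
        μ.rowLen 3 ≤ ν.rowLen 3 ∧ ν.rowLen 2 ≤ μ.rowLen 0 ∧ ν.rowLen 3 ≤ μ.rowLen 1) ∧
      (max (μ.rowLen 0) (ν.rowLen 1) % 2 = ν.rowLen 0 % 2 ∧
        max (μ.rowLen 1) (ν.rowLen 2) % 2 = min (ν.rowLen 1) (μ.rowLen 0) % 2 ∧
        max (μ.rowLen 2) (ν.rowLen 3) % 2 = min (ν.rowLen 2) (μ.rowLen 1) % 2 ∧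
        μ.rowLen 3 % 2 = min (ν.rowLen 3) (μ.rowLen 2) % 2) ∧
      μ.rowLen 0 + μ.rowLen 1 + μ.rowLen 2 + μ.rowLen 3 + 2 * d =
        ν.rowLen 0 + ν.rowLen 1 + ν.rowLen 2 + ν.rowLen 3 ∧
      (k = 0 → μ.rowLen 0 = 0 → ν.rowLen 1 = 0) := by
  have zμ : ∀ i, μ.rowLen (i + 4) = 0 := fun i => by
    have := μ.rowLen_anti 4 (i + 4) (by omega)
    omega
  have zν : ∀ i, ν.rowLen (i + 4) = 0 := fun i => by
    have := ν.rowLen_anti 4 (i + 4) (by omega)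
    omega
  rw [StripStep, card_eq_of_rowLen_four hμ, card_eq_of_rowLen_four hν]
  refine Iff.trans (and_congr_left' ?_) and_assoc
  constructor
  · intro h
    refine ⟨⟨h.le 0, h.le 1, h.le 2, h.le 3, h.two 0, h.two 1⟩, h.parity 0, h.parity 1,
      h.parity 2, ?_⟩
    simpa [stripStart, stripEnd, hν] using h.parity 3
  · rintro ⟨⟨h0, h1, h2, h3, h4, h5⟩, p0, p1, p2, p3⟩
    refine ⟨fun i => ?_, fun i => ?_, fun i => ?_⟩
    · match i with
      | 0 => exact h0
      | 1 => exact h1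
      | 2 => exact h2
      | 3 => exact h3
      | i + 4 => rw [zμ, zν]
    · match i with
      | 0 => exact h4
      | 1 => exact h5
      | i + 2 => rw [zν i]; exact Nat.zero_le _
    · match i with
      | 0 => exact p0
      | 1 => exact p1
      | 2 => exact p2
      | 3 => simpa [stripStart, stripEnd, hν] using p3
      | i + 4 =>
        have e1 : stripStart μ ν (i + 4) = 0 := by
          rw [stripStart, zμ, zν (i + 1)]
          rfl
        have e2 := stripEnd_le μ ν (i + 4)
        rw [zν] at e2
        rw [e1, Nat.le_zero.1 e2]

theorem stripStep_diagram_iff {k d a b c e a' b' c' e' : ℕ} (h1 : b ≤ a) (h2 : c ≤ b) (h3 : e ≤ c)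
    (h1' : b' ≤ a') (h2' : c' ≤ b') (h3' : e' ≤ c') :
    StripStep k d (diagram [a', b', c', e']) (diagram [a, b, c, e]) ↔
      (a' ≤ a ∧ b' ≤ b ∧ c' ≤ c ∧ e' ≤ e ∧ c ≤ a' ∧ e ≤ b') ∧
      (max a' b % 2 = a % 2 ∧ max b' c % 2 = min b a' % 2 ∧ max c' e % 2 = min c b' % 2 ∧
        e' % 2 = min e c' % 2) ∧
      a' + b' + c' + e' + 2 * d = a + b + c + e ∧ (k = 0 → a' = 0 → b = 0) := by
  obtain ⟨p0, p1, p2, p3, p4⟩ := rowLen_diagram_four h1 h2 h3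
  obtain ⟨q0, q1, q2, q3, q4⟩ := rowLen_diagram_four h1' h2' h3'
  rw [stripStep_iff (q4 0) (p4 0), p0, p1, p2, p3, q0, q1, q2, q3]

/-! ### The family of shapes of the signed arc permutations -/

/-- Indices of the shapes of `2 * n` with two rows, of the shapes `(a, b, 1, 1)`, and of the shapes
`(a, b, 2)` together with `(2 * n - 2, 1, 1)` (which has index `0`). -/
def famIndex (n : ℕ) : Finset (ℕ ⊕ ℕ ⊕ ℕ) :=
  (range (n + 1)).disjSum ((Icc 1 (n - 1)).disjSum ((range n).filter fun b => b ≠ 1 ∧ 2 ≤ n))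

/-- The shapes of the family. -/
noncomputable def famShape (n : ℕ) : ℕ ⊕ ℕ ⊕ ℕ → YoungDiagram
  | .inl b => diagram [2 * n - b, b, 0, 0]
  | .inr (.inl b) => diagram [2 * n - 2 - b, b, 1, 1]
  | .inr (.inr b) => if b = 0 then diagram [2 * n - 2, 1, 1, 0] else diagram [2 * n - 2 - b, b, 2, 0]

theorem mem_famIndex_inl {n b : ℕ} : Sum.inl b ∈ famIndex n ↔ b ≤ n := by
  simp [famIndex]

theorem mem_famIndex_inr_inl {n b : ℕ} : Sum.inr (Sum.inl b) ∈ famIndex n ↔ 1 ≤ b ∧ b + 1 ≤ n := by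
  simp [famIndex]
  omega

/-- The index 1 is left out because (2n - 3, 1, 2) is not a partition, and n = 1 because (0, 1, 1)
is not. Index 0 is given to (2n - 2, 1, 1) because, for adding strips within this branch, that shape
behaves like a second row of length 0. -/
theorem mem_famIndex_inr_inr {n b : ℕ} :
    Sum.inr (Sum.inr b) ∈ famIndex n ↔ b < n ∧ b ≠ 1 ∧ 2 ≤ n := by
  simp [famIndex]

theorem famShape_injOn (n : ℕ) : Set.InjOn (famShape n) (famIndex n) := by
  rintro (x | x | x) hx (y | y | y) hy h <;>
    simp only [mem_coe, mem_famIndex_inl, mem_famIndex_inr_inl, mem_famIndex_inr_inr] at hx hy <;>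
    simp only [famShape] at h <;> (try split_ifs at h) <;>
    have := diagram_four_injective (by omega) (by omega) (by omega) (by omega) (by omega)
      (by omega) h <;>
    simp only [Sum.inl.injEq, Sum.inr.injEq, reduceCtorEq] <;>
    omega

/-- Closure of the family under removal of a strip. The parity conditions exclude the other
candidates: a third row of length 1 without a fourth row, for instance, forces the second row to
have length 1. -/
theorem exists_famShape_eq {n k d : ℕ} {x : ℕ ⊕ ℕ ⊕ ℕ} (hx : x ∈ famIndex (n + d))
    {μ : YoungDiagram} (h : StripStep k d μ (famShape (n + d) x)) :
    ∃ y ∈ famIndex n, famShape n y = μ := by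
  have a1 := μ.rowLen_anti 0 1 (by omega)
  have a2 := μ.rowLen_anti 1 2 (by omega)
  have a3 := μ.rowLen_anti 2 3 (by omega)
  have hle := h.1.le 4
  have key : ∀ y ∈ famIndex n, ∀ a b c e, famShape n y = diagram [a, b, c, e] →
      μ.rowLen 4 = 0 → a = μ.rowLen 0 → b = μ.rowLen 1 → c = μ.rowLen 2 → e = μ.rowLen 3 →
      ∃ y ∈ famIndex n, famShape n y = μ := by
    rintro y hy a b c e he h4 rfl rfl rfl rfl
    exact ⟨y, hy, he.trans (eq_diagram_four h4).symm⟩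
  have main : ∀ {a b c e : ℕ}, b ≤ a → c ≤ b → e ≤ c → famShape (n + d) x = diagram [a, b, c, e] →
      μ.rowLen 4 = 0 ∧ ((μ.rowLen 0 ≤ a ∧ μ.rowLen 1 ≤ b ∧ μ.rowLen 2 ≤ c ∧ μ.rowLen 3 ≤ e ∧
      c ≤ μ.rowLen 0 ∧ e ≤ μ.rowLen 1) ∧ (max (μ.rowLen 0) b % 2 = a % 2 ∧
      max (μ.rowLen 1) c % 2 = min b (μ.rowLen 0) % 2 ∧
      max (μ.rowLen 2) e % 2 = min c (μ.rowLen 1) % 2 ∧ μ.rowLen 3 % 2 = min e (μ.rowLen 2) % 2) ∧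
      μ.rowLen 0 + μ.rowLen 1 + μ.rowLen 2 + μ.rowLen 3 + 2 * d = a + b + c + e ∧
      (k = 0 → μ.rowLen 0 = 0 → b = 0)) := by
    intro a b c e h1 h2 h3 he
    obtain ⟨p0, p1, p2, p3, p4⟩ := rowLen_diagram_four h1 h2 h3
    rw [he, p4 0] at hle
    have hμ := Nat.le_zero.1 hle
    rw [he, stripStep_iff hμ (p4 0), p0, p1, p2, p3] at h
    exact ⟨hμ, h⟩
  rcases x with b | b | b
  · rw [mem_famIndex_inl] at hx
    obtain ⟨h4, h⟩ := main (by omega) (by omega) (by omega) rfl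
    exact key (.inl (μ.rowLen 1)) (mem_famIndex_inl.2 (by omega)) _ _ _ _ rfl h4 (by omega)
      (by omega) (by omega) (by omega)
  · rw [mem_famIndex_inr_inl] at hx
    obtain ⟨h4, h⟩ := main (by omega) (by omega) (by omega) rfl
    by_cases hc : μ.rowLen 2 = 0
    · exact key (.inl (μ.rowLen 1)) (mem_famIndex_inl.2 (by omega)) _ _ _ _ rfl h4 (by omega)
        (by omega) (by omega) (by omega)
    · exact key (.inr (.inl (μ.rowLen 1))) (mem_famIndex_inr_inl.2 (by omega)) _ _ _ _ rfl h4
        (by omega) (by omega) (by omega) (by omega)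
  · rw [mem_famIndex_inr_inr] at hx
    by_cases hb : b = 0
    · obtain ⟨h4, h⟩ := main (a := 2 * (n + d) - 2) (b := 1) (c := 1) (e := 0) (by omega)
        (by omega) (by omega) (by simp [famShape, hb])
      by_cases hc : μ.rowLen 2 = 0
      · exact key (.inl (μ.rowLen 1)) (mem_famIndex_inl.2 (by omega)) _ _ _ _ rfl h4 (by omega)
          (by omega) (by omega) (by omega)
      · exact key (.inr (.inr 0)) (mem_famIndex_inr_inr.2 (by omega)) _ _ _ _ rfl h4
          (by omega) (by omega) (by omega) (by omega)
    · obtain ⟨h4, h⟩ := main (a := 2 * (n + d) - 2 - b) (b := b) (c := 2) (e := 0) (by omega)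
        (by omega) (by omega) (by simp [famShape, hb])
      by_cases hc : μ.rowLen 2 = 0
      · exact key (.inl (μ.rowLen 1)) (mem_famIndex_inl.2 (by omega)) _ _ _ _ rfl h4 (by omega)
          (by omega) (by omega) (by omega)
      · by_cases hc1 : μ.rowLen 2 = 1
        · exact key (.inr (.inr 0)) (mem_famIndex_inr_inr.2 (by omega)) _ _ _ _ rfl h4
            (by omega) (by omega) (by omega) (by omega)
        · exact key (.inr (.inr (μ.rowLen 1))) (mem_famIndex_inr_inr.2 (by omega)) _ _ _ _
            (if_neg (by omega)) h4 (by omega) (by omega) (by omega) (by omega)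

/-- The number of two-row shapes, indexed by the second row, that are obtained from the shape
`(a', b')` by adding a horizontal domino strip. -/
theorem card_filter_twoRow {a' b' n' n : ℕ} (h : a' + b' = 2 * n') (hb : b' ≤ a') :
    ((range (n + 1)).filter fun b => b' ≤ b ∧ a' + b ≤ 2 * n ∧ (b ≤ a' → b % 2 = b' % 2)).card =
      n + 1 - n' := by
  rw [← card_range (n + 1 - n')]
  symm
  -- The admissible second rows in increasing order: steps of 2 from b' up to a', where horizontal
  -- dominoes fill the second row, then steps of 1, where vertical dominoes appear. The formulas
  -- meet at t = n' - b', where both give a', and t = n - n' gives the largest admissible value, min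
  -- (2n - a') n.
  refine card_nbij' (fun t => min (b' + 2 * t) (n' + t))
    (fun b => if b ≤ a' then (b - b') / 2 else b - n') ?_ ?_ ?_ ?_
  · intro t ht
    simp only [mem_coe, mem_range, mem_filter] at ht ⊢
    omega
  · intro b hb
    simp only [mem_coe, mem_range, mem_filter] at hb ⊢
    split_ifs <;> omega
  · intro t ht
    simp only [mem_coe, mem_range] at ht ⊢
    split_ifs <;> omega
  · intro b hb
    simp only [mem_coe, mem_range, mem_filter] at hb ⊢
    split_ifs <;> omega

/-- The form in which the two-row count is used for every branch of the family: shapes with further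
rows are compared with two-row shapes of the same or a smaller size. -/
theorem card_filter_eq_of_iff {s : Finset ℕ} {P : ℕ → Prop} [DecidablePred P] {a' b' n' n : ℕ}
    (h : a' + b' = 2 * n') (hb : b' ≤ a')
    (hP : ∀ b, b ∈ s ∧ P b ↔ b ≤ n ∧ b' ≤ b ∧ a' + b ≤ 2 * n ∧ (b ≤ a' → b % 2 = b' % 2)) :
    (s.filter P).card = n + 1 - n' := by
  rw [← card_filter_twoRow h hb]
  congr 1
  ext b
  rw [mem_filter, hP, mem_filter, mem_range, Nat.lt_succ_iff]

/-- The multiplicities of the shapes in the theorem. -/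
def famWeight (n : ℕ) : ℕ ⊕ ℕ ⊕ ℕ → ℕ
  | .inl b => if b = 0 then (if n = 0 then 0 else 1) else if b = 1 then 1 else 2
  | .inr _ => 1

/-- The indicator function of the two-row shapes. -/
def twoRow : ℕ ⊕ ℕ ⊕ ℕ → ℕ
  | .inl _ => 1
  | .inr _ => 0

theorem sum_famIndex (n : ℕ) (g : ℕ ⊕ ℕ ⊕ ℕ → ℕ) : ∑ x ∈ famIndex n, g x =
    ∑ b ∈ range (n + 1), g (.inl b) + (∑ b ∈ Icc 1 (n - 1), g (.inr (.inl b)) +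
      ∑ b ∈ (range n).filter fun b => b ≠ 1 ∧ 2 ≤ n, g (.inr (.inr b))) := by
  rw [famIndex, sum_disjSum, sum_disjSum]

/-! ### Strips between shapes of the family -/

section

variable {k d n : ℕ}

theorem stripStep_inl_inl (hk : k ≠ 0) {b b' : ℕ} (hb' : b' ≤ n) (hb : b ≤ n + d) :
    StripStep k d (famShape n (.inl b')) (famShape (n + d) (.inl b)) ↔
      b' ≤ b ∧ 2 * n - b' + b ≤ 2 * (n + d) ∧ (b ≤ 2 * n - b' → b % 2 = b' % 2) := by
  simp only [famShape]
  rw [stripStep_diagram_iff (by omega) (by omega) (by omega) (by omega) (by omega) (by omega)]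
  omega

theorem card_inl_inl (hk : k ≠ 0) {b' : ℕ} (hb' : b' ≤ n) [DecidablePred fun b =>
    StripStep k d (famShape n (.inl b')) (famShape (n + d) (.inl b))] :
    ((range (n + d + 1)).filter fun b =>
      StripStep k d (famShape n (.inl b')) (famShape (n + d) (.inl b))).card = d + 1 := by
  rw [card_filter_eq_of_iff (a' := 2 * n - b') (b' := b') (n' := n) (n := n + d) (by omega)
    (by omega)]
  · omega
  · intro b
    rw [mem_range, Nat.lt_succ_iff]
    exact and_congr_right fun hb => stripStep_inl_inl hk hb' hb

/-- The column of the third and fourth rows is one vertical domino, standing on a first column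
already of height 2, so b' = 0 is impossible. The other d - 1 dominoes form a two-row strip. -/
theorem card_inl_inr_inl {b' : ℕ} (hb' : b' ≤ n) [DecidablePred fun b =>
    StripStep k d (famShape n (.inl b')) (famShape (n + d) (.inr (.inl b)))] :
    ((Icc 1 (n + d - 1)).filter fun b =>
      StripStep k d (famShape n (.inl b')) (famShape (n + d) (.inr (.inl b)))).card =
      if b' = 0 then 0 else d := by
  split_ifs with h0
  · rw [card_eq_zero, filter_eq_empty_iff]
    intro b hb
    rw [mem_Icc] at hb
    simp only [famShape]
    rw [stripStep_diagram_iff (by omega) (by omega) (by omega) (by omega) (by omega) (by omega)]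
    omega
  · rw [card_filter_eq_of_iff (a' := 2 * n - b') (b' := b') (n' := n) (n := n + d - 1) (by omega)
      (by omega)]
    · omega
    · intro b
      by_cases hb : 1 ≤ b ∧ b ≤ n + d - 1
      · rw [mem_Icc]
        simp only [famShape]
        rw [stripStep_diagram_iff (by omega) (by omega) (by omega) (by omega) (by omega) (by omega)]
        omega
      · rw [mem_Icc]
        refine iff_of_false (fun h => hb h.1) (by omega)

/-- One domino serves to create the third row: a horizontal one for target shapes (a, b, 2), a
vertical one in the first column for (a, 1, 1). The first needs b' ≥ 2 and the second b' = 0 < n; b'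
= 1 allows neither. -/
theorem card_inl_inr_inr {b' : ℕ} (hb' : b' ≤ n) [DecidablePred fun b =>
    StripStep k d (famShape n (.inl b')) (famShape (n + d) (.inr (.inr b)))] :
    (((range (n + d)).filter fun b => b ≠ 1 ∧ 2 ≤ n + d).filter fun b =>
      StripStep k d (famShape n (.inl b')) (famShape (n + d) (.inr (.inr b)))).card =
      if b' = 1 ∨ n = 0 then 0 else d := by
  split_ifs with h0
  · rw [card_eq_zero, filter_eq_empty_iff]
    intro b hb
    rw [mem_filter, mem_range] at hb
    simp only [famShape]
    split_ifs with hb0 <;>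
      rw [stripStep_diagram_iff (by omega) (by omega) (by omega) (by omega) (by omega)
        (by omega)] <;> omega
  · rw [card_filter_eq_of_iff (a' := 2 * n - b') (b' := b') (n' := n) (n := n + d - 1) (by omega)
      (by omega)]
    · omega
    · intro b
      rw [mem_filter, mem_range]
      by_cases hb : b < n + d ∧ b ≠ 1 ∧ 2 ≤ n + d
      · simp only [famShape]
        rcases (by omega : b' = 0 ∨ 2 ≤ b') with h1 | h1 <;> split_ifs with hb0 <;>
          rw [stripStep_diagram_iff (by omega) (by omega) (by omega) (by omega) (by omega)
            (by omega)]
        · omega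
        · rw [h1, max_eq_right (Nat.zero_le 2), min_eq_right (Nat.zero_le 2)]
          omega
        · omega
        · rw [max_eq_left h1, min_eq_left h1]
          omega
      · refine iff_of_false (fun h => hb h.1) (by omega)

theorem not_stripStep_inr_inl {b b' : ℕ} (hb' : Sum.inr (Sum.inl b') ∈ famIndex n)
    (hb : b ≤ n + d) :
    ¬ StripStep k d (famShape n (.inr (.inl b'))) (famShape (n + d) (.inl b)) := by
  rw [mem_famIndex_inr_inl] at hb'
  simp only [famShape]
  rw [stripStep_diagram_iff (by omega) (by omega) (by omega) (by omega) (by omega) (by omega)]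
  omega

theorem not_stripStep_inr_inl_inr {b b' : ℕ} (hb' : Sum.inr (Sum.inl b') ∈ famIndex n)
    (hb : Sum.inr (Sum.inr b) ∈ famIndex (n + d)) :
    ¬ StripStep k d (famShape n (.inr (.inl b'))) (famShape (n + d) (.inr (.inr b))) := by
  rw [mem_famIndex_inr_inl] at hb'
  rw [mem_famIndex_inr_inr] at hb
  simp only [famShape]
  split_ifs <;>
    rw [stripStep_diagram_iff (by omega) (by omega) (by omega) (by omega) (by omega) (by omega)] <;>
    omega

theorem card_inr_inl {b' : ℕ} (hb' : Sum.inr (Sum.inl b') ∈ famIndex n)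
    [DecidablePred fun b =>
      StripStep k d (famShape n (.inr (.inl b'))) (famShape (n + d) (.inr (.inl b)))] :
    ((Icc 1 (n + d - 1)).filter fun b =>
      StripStep k d (famShape n (.inr (.inl b'))) (famShape (n + d) (.inr (.inl b)))).card =
      d + 1 := by
  rw [mem_famIndex_inr_inl] at hb'
  rw [card_filter_eq_of_iff (a' := 2 * n - 2 - b') (b' := b') (n' := n - 1) (n := n + d - 1)
    (by omega) (by omega)]
  · omega
  · intro b
    rw [mem_Icc]
    by_cases hb : 1 ≤ b ∧ b ≤ n + d - 1
    · simp only [famShape]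
      rw [stripStep_diagram_iff (by omega) (by omega) (by omega) (by omega) (by omega) (by omega)]
      omega
    · refine iff_of_false (fun h => hb h.1) (by omega)

theorem not_stripStep_inr_inr {b b' : ℕ} (hb' : Sum.inr (Sum.inr b') ∈ famIndex n)
    (hb : b ≤ n + d) :
    ¬ StripStep k d (famShape n (.inr (.inr b'))) (famShape (n + d) (.inl b)) := by
  rw [mem_famIndex_inr_inr] at hb'
  simp only [famShape]
  split_ifs <;>
    rw [stripStep_diagram_iff (by omega) (by omega) (by omega) (by omega) (by omega) (by omega)] <;>
    omega

theorem not_stripStep_inr_inr_inl {b b' : ℕ} (hb' : Sum.inr (Sum.inr b') ∈ famIndex n)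
    (hb : Sum.inr (Sum.inl b) ∈ famIndex (n + d)) :
    ¬ StripStep k d (famShape n (.inr (.inr b'))) (famShape (n + d) (.inr (.inl b))) := by
  rw [mem_famIndex_inr_inr] at hb'
  rw [mem_famIndex_inr_inl] at hb
  simp only [famShape]
  split_ifs <;>
    rw [stripStep_diagram_iff (by omega) (by omega) (by omega) (by omega) (by omega) (by omega)] <;>
    omega

theorem card_inr_inr {b' : ℕ} (hb' : Sum.inr (Sum.inr b') ∈ famIndex n)
    [DecidablePred fun b =>
      StripStep k d (famShape n (.inr (.inr b'))) (famShape (n + d) (.inr (.inr b)))] :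
    (((range (n + d)).filter fun b => b ≠ 1 ∧ 2 ≤ n + d).filter fun b =>
      StripStep k d (famShape n (.inr (.inr b'))) (famShape (n + d) (.inr (.inr b)))).card =
      d + 1 := by
  rw [mem_famIndex_inr_inr] at hb'
  rw [card_filter_eq_of_iff (a' := 2 * n - 2 - b') (b' := b') (n' := n - 1) (n := n + d - 1)
    (by omega) (by omega)]
  · omega
  · intro b
    rw [mem_filter, mem_range]
    by_cases hb : b < n + d ∧ b ≠ 1 ∧ 2 ≤ n + d
    · simp only [famShape]
      split_ifs with hb0 hb1 <;>
        rw [stripStep_diagram_iff (by omega) (by omega) (by omega) (by omega) (by omega)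
          (by omega)] <;> omega
    · refine iff_of_false (fun h => hb h.1) (by omega)

/-- The deficit 2 - weight of a target is 1 for second rows 0 and 1, and 0 otherwise. By parity a
shape with second row 0 or 1 reaches only the same second row among these. The empty shape reaches
both, which is why its weight is 0. -/
theorem sum_two_sub_famWeight (hk : k ≠ 0) {b' : ℕ} (hb' : b' ≤ n) (hd : d ≠ 0)
    [DecidablePred fun b => StripStep k d (famShape n (.inl b')) (famShape (n + d) (.inl b))] :
    ∑ b ∈ (range (n + d + 1)).filter fun b =>
      StripStep k d (famShape n (.inl b')) (famShape (n + d) (.inl b)),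
      (2 - famWeight (n + d) (.inl b)) = 2 - famWeight n (.inl b') := by
  have hw : ∀ b, 2 - famWeight (n + d) (.inl b) = if b ≤ 1 then 1 else 0 := by
    intro b
    simp only [famWeight]
    split_ifs <;> omega
  simp only [hw, ← sum_filter, ← card_eq_sum_ones, filter_filter]
  have hfil : ∀ s : Finset ℕ, (∀ b, b ∈ s ↔ b ≤ n + d ∧ (b' ≤ b ∧ 2 * n - b' + b ≤ 2 * (n + d) ∧
      (b ≤ 2 * n - b' → b % 2 = b' % 2)) ∧ b ≤ 1) →
      (range (n + d + 1)).filter (fun b =>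
        StripStep k d (famShape n (.inl b')) (famShape (n + d) (.inl b)) ∧ b ≤ 1) = s := by
    intro s hs
    ext b
    rw [mem_filter, mem_range, Nat.lt_succ_iff, hs]
    exact and_congr_right fun hb => and_congr_left' (stripStep_inl_inl hk hb' hb)
  simp only [famWeight]
  -- The cases are the empty shape, second row 0 with n > 0, second row 1, and longer second rows.
  split_ifs with h0 h1 h2
  · rw [hfil {0, 1}]
    · rfl
    · intro b
      simp only [mem_insert, mem_singleton]
      omega
  · rw [hfil {0}]
    · rfl
    · intro b
      simp only [mem_singleton]
      omega
  · rw [hfil {1}]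
    · rfl
    · intro b
      simp only [mem_singleton]
      omega
  · rw [hfil ∅]
    · rfl
    · intro b
      simp only [notMem_empty, false_iff]
      omega

open Classical in
-- Strips never remove rows, so only two-row shapes lead to two-row shapes, and each does so in d +
-- 1 ways.
theorem sum_twoRow_stripStep (hk : k ≠ 0) {y : ℕ ⊕ ℕ ⊕ ℕ} (hy : y ∈ famIndex n) :
    ∑ x ∈ famIndex (n + d),
      (if StripStep k d (famShape n y) (famShape (n + d) x) then twoRow x else 0) =
      (d + 1) * twoRow y := by
  rw [sum_famIndex]
  simp only [twoRow, ite_self, sum_const_zero, add_zero]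
  rw [← sum_filter, ← card_eq_sum_ones]
  rcases y with b' | b' | b'
  · rw [card_inl_inl hk (mem_famIndex_inl.1 hy), mul_one]
  · rw [mul_zero, card_eq_zero, filter_eq_empty_iff]
    intro b hb
    exact not_stripStep_inr_inl hy (Nat.lt_succ_iff.1 (mem_range.1 hb))
  · rw [mul_zero, card_eq_zero, filter_eq_empty_iff]
    intro b hb
    exact not_stripStep_inr_inr hy (Nat.lt_succ_iff.1 (mem_range.1 hb))

open Classical in
-- For a two-row shape of weight w, the two-row targets contribute 2 (d + 1) - (2 - w) and the other
-- targets d w, with sum (d + 1) w + 2 d. Each remaining shape has d + 1 targets, all in its own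
-- branch and of weight 1.
theorem sum_famWeight_stripStep (hk : k ≠ 0) (hd : d ≠ 0) {y : ℕ ⊕ ℕ ⊕ ℕ} (hy : y ∈ famIndex n) :
    ∑ x ∈ famIndex (n + d),
      (if StripStep k d (famShape n y) (famShape (n + d) x) then famWeight (n + d) x else 0) =
      (d + 1) * famWeight n y + 2 * d * twoRow y := by
  rw [sum_famIndex]
  have e : ∀ b : ℕ ⊕ ℕ, famWeight (n + d) (.inr b) = 1 := fun _ => rfl
  simp only [e]
  simp only [← sum_filter (p := fun b => StripStep k d _ (famShape (n + d) _)), ← card_eq_sum_ones]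
  have none_inr : ∀ z, y = .inr z → ((range (n + d + 1)).filter fun b =>
      StripStep k d (famShape n y) (famShape (n + d) (.inl b))) = ∅ := by
    rintro z rfl
    rw [filter_eq_empty_iff]
    intro b hb
    have hb := Nat.lt_succ_iff.1 (mem_range.1 hb)
    rcases z with b' | b'
    · exact not_stripStep_inr_inl hy hb
    · exact not_stripStep_inr_inr hy hb
  rcases y with b' | b' | b'
  · have hb' := mem_famIndex_inl.1 hy
    rw [card_inl_inr_inl hb', card_inl_inr_inr hb']
    have h1 := sum_two_sub_famWeight hk hb' hd
    have h2 := card_inl_inl (d := d) hk hb'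
    have h3 : ∀ m b, famWeight m (.inl b) ≤ 2 := by
      intro m b
      simp only [famWeight]
      split_ifs <;> omega
    have h4 : ∑ b ∈ (range (n + d + 1)).filter (fun b =>
        StripStep k d (famShape n (.inl b')) (famShape (n + d) (.inl b))),
          ((2 - famWeight (n + d) (.inl b)) + famWeight (n + d) (.inl b)) = (d + 1) * 2 := by
      rw [sum_const_nat (m := 2) fun b _ => Nat.sub_add_cancel (h3 _ _), h2]
    rw [sum_add_distrib, h1] at h4
    have h5 := h3 n b'
    have h6 : ((if b' = 0 then 0 else d) + if b' = 1 ∨ n = 0 then 0 else d) =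
        d * famWeight n (.inl b') := by
      simp only [famWeight]
      split_ifs <;> omega
    rw [h6, add_one_mul]
    simp only [twoRow]
    omega
  · rw [none_inr _ rfl, sum_empty, card_inr_inl hy]
    have : ((range (n + d)).filter fun b => b ≠ 1 ∧ 2 ≤ n + d).filter (fun b =>
      StripStep k d (famShape n (.inr (.inl b'))) (famShape (n + d) (.inr (.inr b)))) = ∅ := by
      rw [filter_eq_empty_iff]
      intro b hb
      rw [mem_filter, mem_range] at hb
      exact not_stripStep_inr_inl_inr hy (mem_famIndex_inr_inr.2 hb)
    rw [this]
    simp [famWeight, twoRow]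
  · rw [none_inr _ rfl, sum_empty, card_inr_inr hy]
    have : (Icc 1 (n + d - 1)).filter (fun b =>
      StripStep k d (famShape n (.inr (.inr b'))) (famShape (n + d) (.inr (.inl b)))) = ∅ := by
      rw [filter_eq_empty_iff]
      intro b hb
      rw [mem_Icc] at hb
      exact not_stripStep_inr_inr_inl hy (mem_famIndex_inr_inl.2 (by omega))
    rw [this]
    simp [famWeight, twoRow]

end

/-! ### Two-coloured words of given content -/

/-- The ways to split a content into a negative and a positive part, with no negative zeros. -/
noncomputable def signSplits (m : ℕ →₀ ℕ) : Finset ((ℕ →₀ ℕ) × (ℕ →₀ ℕ)) :=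
  (antidiagonal m).filter fun p => p.1 0 = 0

/-- The number of signed letters of a given content, together with a distinguished letter. -/
noncomputable def pointedCount (m : ℕ →₀ ℕ) : ℕ :=
  ∑ p ∈ signSplits m, (p.1.support.card + p.2.support.card)

theorem card_support_add_single {f : ℕ →₀ ℕ} {k : ℕ} (hf : f k = 0) (e : ℕ) :
    (f + Finsupp.single k e).support.card = f.support.card + if e = 0 then 0 else 1 := by
  split_ifs with h
  · simp [h]
  · rw [Finsupp.support_add_eq, card_union_of_disjoint, Finsupp.support_single _ h,
      card_singleton] <;> simp [Finsupp.support_single _ h, hf]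

/-- As k is neither 0 nor in the support of `m`, its d copies are distributed over the two signs
independently of the rest and without restriction. -/
theorem sum_signSplits_add_single {m : ℕ →₀ ℕ} {k d : ℕ} (hk : k ≠ 0) (hm : m k = 0)
    (g : (ℕ →₀ ℕ) × (ℕ →₀ ℕ) → ℕ) :
    ∑ p ∈ signSplits (m + Finsupp.single k d), g p = ∑ p ∈ signSplits m, ∑ e ∈ antidiagonal d,
      g (p.1 + Finsupp.single k e.1, p.2 + Finsupp.single k e.2) := by
  rw [← sum_product']
  have herase : ∀ p : ℕ →₀ ℕ, p k = 0 → p.erase k = p := fun p hp =>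
    Finsupp.erase_of_notMem_support (by simpa using hp)
  symm
  refine sum_nbij' (fun x => (x.1.1 + Finsupp.single k x.2.1, x.1.2 + Finsupp.single k x.2.2))
    (fun p => ((p.1.erase k, p.2.erase k), (p.1 k, p.2 k))) ?_ ?_ ?_ ?_ ?_
  · rintro ⟨⟨p, q⟩, ⟨e, e'⟩⟩ hx
    simp only [signSplits, mem_product, mem_filter, HasAntidiagonal.mem_antidiagonal] at hx ⊢
    obtain ⟨⟨rfl, h0⟩, rfl⟩ := hx
    refine ⟨?_, by simp [h0, hk]⟩
    rw [Finsupp.single_add]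
    abel
  · rintro ⟨p, q⟩ hp
    simp only [signSplits, mem_product, mem_filter, HasAntidiagonal.mem_antidiagonal] at hp ⊢
    refine ⟨⟨?_, by rw [Finsupp.erase_ne hk.symm]; exact hp.2⟩, ?_⟩
    · rw [← Finsupp.erase_add, hp.1, Finsupp.erase_add, Finsupp.erase_single, add_zero, herase _ hm]
    · rw [← Finsupp.add_apply, hp.1]
      simp [hm]
  · rintro ⟨⟨p, q⟩, ⟨e, e'⟩⟩ hx
    simp only [signSplits, mem_product, mem_filter, HasAntidiagonal.mem_antidiagonal] at hx
    obtain ⟨⟨rfl, -⟩, -⟩ := hx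
    rw [Finsupp.add_apply] at hm
    have hp : p k = 0 := by omega
    have hq : q k = 0 := by omega
    simp [Finsupp.erase_add, hp, hq]
  · rintro ⟨p, q⟩ -
    simp [Finsupp.erase_add_single]
  · intros
    rfl

theorem card_signSplits_add_single {m : ℕ →₀ ℕ} {k d : ℕ} (hk : k ≠ 0) (hm : m k = 0) :
    (signSplits (m + Finsupp.single k d)).card = (d + 1) * (signSplits m).card := by
  rw [card_eq_sum_ones, sum_signSplits_add_single hk hm]
  simp [mul_comm]

/-- Each splitting extends in d + 1 ways; the new letter occurs negatively in d of them and
positively in d of them, whence the additional 2 d. -/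
theorem pointedCount_add_single {m : ℕ →₀ ℕ} {k d : ℕ} (hk : k ≠ 0) (hm : m k = 0) :
    pointedCount (m + Finsupp.single k d) =
      (d + 1) * pointedCount m + 2 * d * (signSplits m).card := by
  rw [pointedCount, sum_signSplits_add_single hk hm]
  have h1 : ∀ p ∈ signSplits m, ∑ e ∈ antidiagonal d,
      ((p.1 + Finsupp.single k e.1).support.card + (p.2 + Finsupp.single k e.2).support.card) =
      (d + 1) * (p.1.support.card + p.2.support.card) + 2 * d := by
    rintro ⟨p, q⟩ hp
    simp only [signSplits, mem_filter, HasAntidiagonal.mem_antidiagonal] at hp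
    obtain ⟨rfl, -⟩ := hp
    rw [Finsupp.add_apply] at hm
    have hp : p k = 0 := by omega
    have hq : q k = 0 := by omega
    simp only [card_support_add_single hp, card_support_add_single hq]
    have h2 : ∑ e ∈ antidiagonal d, (if e.1 = 0 then 0 else 1) = d := by
      rw [Nat.sum_antidiagonal_eq_sum_range_succ (fun i _ => if i = 0 then 0 else 1),
        sum_range_succ']
      simp
    have h3 : ∑ e ∈ antidiagonal d, (if e.2 = 0 then 0 else 1) = d := by
      rw [← Nat.sum_antidiagonal_swap]
      exact h2
    simp only [sum_add_distrib, h2, h3, sum_const, Nat.card_antidiagonal, smul_eq_mul]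
    ring
  rw [sum_congr rfl h1, sum_add_distrib, ← mul_sum, sum_const, smul_eq_mul, pointedCount]
  ring

theorem signSplits_single_zero (d : ℕ) :
    signSplits (Finsupp.single 0 d) = {(0, Finsupp.single 0 d)} := by
  ext ⟨p, q⟩
  simp only [signSplits, mem_filter, HasAntidiagonal.mem_antidiagonal, mem_singleton, Prod.mk.injEq]
  constructor
  · rintro ⟨h, h0⟩
    have hp : p = 0 := by
      ext i
      by_cases hi : i = 0
      · rw [hi, h0]
        rfl
      · have := DFunLike.congr_fun h i
        rw [Finsupp.add_apply, Finsupp.single_eq_of_ne hi] at this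
        simp only [Finsupp.coe_zero, Pi.zero_apply]
        omega
    subst hp
    exact ⟨rfl, (zero_add q).symm.trans h⟩
  · rintro ⟨rfl, rfl⟩
    simp

/-! ### The weighted number of tableaux -/

/-- The number of tableaux of weight `m` with shapes in the family, weighted by `w`. -/
noncomputable def famCount (w : ℕ ⊕ ℕ ⊕ ℕ → ℕ) (m : ℕ →₀ ℕ) : ℕ :=
  ∑ x ∈ famIndex m.degree, w x * tabCount (famShape m.degree x) m

open Classical in
-- The transfer matrix acts on weights: summing first over the larger shape turns the weight `w`
-- into the weight `w'` on the smaller one.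
theorem famCount_add_single {m : ℕ →₀ ℕ} {k d : ℕ} (hm : ∀ i ∈ m.support, i < k)
    (w w' : ℕ ⊕ ℕ ⊕ ℕ → ℕ)
    (hw : ∀ y ∈ famIndex m.degree, ∑ x ∈ famIndex (m.degree + d),
      (if StripStep k d (famShape m.degree y) (famShape (m.degree + d) x) then w x else 0) =
      w' y) :
    famCount w (m + Finsupp.single k d) = famCount w' m := by
  have hdeg : (m + Finsupp.single k d).degree = m.degree + d := by
    rw [map_add, Finsupp.degree_single]
  rw [famCount, famCount, hdeg]
  have h1 : ∀ x ∈ famIndex (m.degree + d),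
      w x * tabCount (famShape (m.degree + d) x) (m + Finsupp.single k d) =
      ∑ y ∈ famIndex m.degree,
        (if StripStep k d (famShape m.degree y) (famShape (m.degree + d) x) then w x else 0) *
          tabCount (famShape m.degree y) m := by
    intro x hx
    rw [tabCount_add_single _ m k d hm (famIndex m.degree) (famShape m.degree)
      (famShape_injOn _) (fun μ hμ => exists_famShape_eq hx hμ), mul_sum]
    refine sum_congr rfl fun y _ => ?_
    split_ifs <;> simp
  rw [sum_congr rfl h1, sum_comm]
  refine sum_congr rfl fun y hy => ?_
  rw [← sum_mul, hw y hy]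

theorem tabCount_zero {μ : YoungDiagram} (h : μ.card = 0) : tabCount μ 0 = 1 := by
  have hμ : μ.cells = ∅ := card_eq_zero.1 h
  have : tabSet μ 0 = {∅} := by
    ext L
    rw [Set.mem_singleton_iff]
    constructor
    · rintro ⟨-, hL⟩
      rw [eq_empty_iff_forall_notMem]
      intro x hx
      exact labelWeight_ne_zero hx (by rw [hL]; rfl)
    · rintro rfl
      refine ⟨⟨?_, ?_, ?_, ?_, ?_, ?_⟩, rfl⟩ <;> try simp
      intro i j hc
      rw [← YoungDiagram.mem_cells, hμ] at hc
      exact absurd hc (notMem_empty _)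
  rw [tabCount, this, Nat.card_coe_set_eq, Set.ncard_singleton]

theorem famCount_zero (w : ℕ ⊕ ℕ ⊕ ℕ → ℕ) : famCount w 0 = w (.inl 0) := by
  have h : famIndex (0 : ℕ →₀ ℕ).degree = {.inl 0} := by
    rw [map_zero]
    rfl
  rw [famCount, h, sum_singleton, tabCount_zero, mul_one]
  obtain ⟨p0, p1, p2, p3, p4⟩ := rowLen_diagram_four (a := 0) (b := 0) (c := 0) (e := 0)
    le_rfl le_rfl le_rfl
  simp only [map_zero, famShape, mul_zero, Nat.sub_zero]
  rw [card_eq_of_rowLen_four (p4 0)]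
  omega

/-- The corner condition allows dominoes labelled 0 only in a single row. -/
theorem stripStep_zero_iff {d : ℕ} {x y : ℕ ⊕ ℕ ⊕ ℕ} (hy : y ∈ famIndex 0)
    (hx : x ∈ famIndex (0 + d)) :
    StripStep 0 d (famShape 0 y) (famShape (0 + d) x) ↔ x = .inl 0 := by
  obtain rfl : y = .inl 0 := mem_singleton.1 hy
  rcases x with b | b | b <;>
    simp only [mem_famIndex_inl, mem_famIndex_inr_inl, mem_famIndex_inr_inr] at hx <;>
    simp only [famShape] <;> (try split_ifs) <;>
    rw [stripStep_diagram_iff (by omega) (by omega) (by omega) (by omega) (by omega) (by omega)] <;>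
    simp only [Sum.inl.injEq, reduceCtorEq, mul_zero, Nat.zero_sub,
      forall_const, iff_false] <;> omega

theorem famCount_single_zero (w : ℕ ⊕ ℕ ⊕ ℕ → ℕ) (d : ℕ) :
    famCount w (Finsupp.single 0 d) = w (.inl 0) := by
  classical
  rw [← zero_add (Finsupp.single 0 d), famCount_add_single (by simp) w fun _ => w (.inl 0)]
  · rw [famCount_zero]
  · intro y hy
    rw [map_zero] at hy ⊢
    rw [sum_congr rfl fun x hx => if_congr (stripStep_zero_iff hy hx) rfl rfl, sum_ite_eq_of_mem']
    rw [mem_famIndex_inl]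
    omega

theorem famCount_twoRow (m : ℕ →₀ ℕ) : famCount twoRow m = (signSplits m).card := by
  classical
  induction m using Finsupp.induction_on_max₂ with
  | zero =>
    rw [← Finsupp.single_zero 0, signSplits_single_zero, famCount_single_zero]
    rfl
  | add_single k d m hm hd ih =>
    by_cases hk : k = 0
    · obtain rfl : m = 0 := by
        rw [← Finsupp.support_eq_empty, eq_empty_iff_forall_notMem]
        intro i hi
        have := hm i hi
        omega
      rw [hk, zero_add, signSplits_single_zero, famCount_single_zero]
      rfl
    · have hmk : m k = 0 := by
        by_contra hne
        exact lt_irrefl _ (hm k (Finsupp.mem_support_iff.2 hne))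
      rw [card_signSplits_add_single hk hmk, ← ih, famCount_add_single hm twoRow
        (fun y => (d + 1) * twoRow y) fun y hy => sum_twoRow_stripStep hk hy]
      simp only [famCount, mul_sum, mul_assoc]

theorem famCount_famWeight (m : ℕ →₀ ℕ) : famCount (famWeight m.degree) m = pointedCount m := by
  classical
  have hbase : ∀ d, pointedCount (Finsupp.single 0 d) = if d = 0 then 0 else 1 := by
    intro d
    rw [pointedCount, signSplits_single_zero, sum_singleton]
    split_ifs with h
    · simp [h]
    · simp [Finsupp.support_single _ h]
  induction m using Finsupp.induction_on_max₂ with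
  | zero =>
    rw [← Finsupp.single_zero 0, hbase, famCount_single_zero, Finsupp.degree_single]
    rfl
  | add_single k d m hm hd ih =>
    by_cases hk : k = 0
    · obtain rfl : m = 0 := by
        rw [← Finsupp.support_eq_empty, eq_empty_iff_forall_notMem]
        intro i hi
        have := hm i hi
        omega
      rw [hk, zero_add, hbase, famCount_single_zero, Finsupp.degree_single]
      simp [famWeight]
    · have hmk : m k = 0 := by
        by_contra hne
        exact lt_irrefl _ (hm k (Finsupp.mem_support_iff.2 hne))
      have hdeg : (m + Finsupp.single k d).degree = m.degree + d := by
        rw [map_add, Finsupp.degree_single]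
      rw [pointedCount_add_single hk hmk, ← ih, ← famCount_twoRow, hdeg,
        famCount_add_single hm (famWeight (m.degree + d))
        (fun y => (d + 1) * famWeight m.degree y + 2 * d * twoRow y)
        fun y hy => sum_famWeight_stripStep hk hd hy]
      simp only [famCount, mul_sum, add_mul (_ * _), sum_add_distrib, mul_assoc]

/-! ### Values of signed permutations -/

namespace SignedPerm

variable {n : ℕ}

theorem val_eq (π : SignedPerm n) {i : ℕ} (h : i ≤ n) :
    π.val i = (π.1 ⟨(i : ℤ), by constructor <;> omega⟩ : ℤ) := by
  rw [SignedPerm.val, dif_pos h]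

theorem apply_neg (π : SignedPerm n) {i : ℕ} (h : i ≤ n) :
    (π.1 ⟨-(i : ℤ), by constructor <;> omega⟩ : ℤ) = -π.val i := by
  rw [π.val_eq h]
  exact π.2 _ _ rfl

theorem val_zero (π : SignedPerm n) : π.val 0 = 0 := by
  have h := π.apply_neg (Nat.zero_le n)
  rw [π.val_eq (Nat.zero_le n)] at h ⊢
  simp only [Nat.cast_zero, neg_zero] at h ⊢
  omega

theorem natAbs_val_le (π : SignedPerm n) {i : ℕ} (h : i ≤ n) : (π.val i).natAbs ≤ n := by
  rw [π.val_eq h]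
  have := (π.1 ⟨(i : ℤ), by constructor <;> omega⟩).2
  rw [Set.mem_Icc] at this
  omega

theorem val_injOn (π : SignedPerm n) {i j : ℕ} (hi : i ≤ n) (hj : j ≤ n)
    (h : π.val i = π.val j) : i = j := by
  rw [π.val_eq hi, π.val_eq hj] at h
  have := congrArg Subtype.val (π.1.injective (Subtype.ext h))
  simpa using this

theorem eq_zero_of_val_eq_neg (π : SignedPerm n) {i j : ℕ} (hi : i ≤ n) (hj : j ≤ n)
    (h : π.val i = -π.val j) : i = 0 ∧ j = 0 := by
  rw [π.val_eq hi, ← π.apply_neg hj] at h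
  have := congrArg Subtype.val (π.1.injective (Subtype.ext h))
  simp only at this
  omega

theorem natAbs_val_injOn (π : SignedPerm n) {i j : ℕ} (hi : i ≤ n) (hj : j ≤ n)
    (h : (π.val i).natAbs = (π.val j).natAbs) : i = j := by
  rcases Int.natAbs_eq_natAbs_iff.1 h with h | h
  · exact π.val_injOn hi hj h
  · have := π.eq_zero_of_val_eq_neg hi hj h
    omega

theorem one_le_natAbs_val (π : SignedPerm n) {i : ℕ} (h1 : 1 ≤ i) (h : i ≤ n) :
    1 ≤ (π.val i).natAbs := by
  by_contra! h0
  have : (π.val i).natAbs = (π.val 0).natAbs := by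
    rw [π.val_zero]
    omega
  have := π.natAbs_val_injOn h (Nat.zero_le n) this
  omega

theorem ext_val {π π' : SignedPerm n} (h : ∀ i, 1 ≤ i → i ≤ n → π.val i = π'.val i) :
    π = π' := by
  have h' : ∀ i ≤ n, π.val i = π'.val i := by
    intro i hi
    rcases Nat.eq_zero_or_pos i with rfl | hi'
    · rw [π.val_zero, π'.val_zero]
    · exact h i hi' hi
  refine Subtype.ext (Equiv.ext fun x => Subtype.ext ?_)
  obtain ⟨x, hx⟩ := x
  rw [Set.mem_Icc] at hx
  obtain ⟨i, rfl | rfl⟩ := Int.eq_nat_or_neg x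
  · have := h' i (by omega)
    rwa [π.val_eq (by omega), π'.val_eq (by omega)] at this
  · have := h' i (by omega)
    rw [π.apply_neg (by omega), π'.apply_neg (by omega), this]

theorem exists_val_eq {v : ℕ → ℤ} (h1 : ∀ i, 1 ≤ i → i ≤ n → 1 ≤ (v i).natAbs ∧ (v i).natAbs ≤ n)
    (h2 : ∀ i j, 1 ≤ i → i ≤ n → 1 ≤ j → j ≤ n → (v i).natAbs = (v j).natAbs → i = j) :
    ∃ π : SignedPerm n, ∀ i, 1 ≤ i → i ≤ n → π.val i = v i := by
  -- The odd extension of `v`; the factor `x.sign` also gives the value 0 at 0.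
  let w : ℤ → ℤ := fun x => x.sign * v x.natAbs
  have hw : ∀ x : ℤ, x ≠ 0 → (w x).natAbs = (v x.natAbs).natAbs := by
    intro x hx
    simp only [w, Int.natAbs_mul, Int.natAbs_sign_of_ne_zero hx, one_mul]
  have hw0 : w 0 = 0 := by simp [w]
  have hneg : ∀ x, w (-x) = -w x := by
    intro x
    simp [w]
  have hmem : ∀ x ∈ Set.Icc (-(n : ℤ)) n, w x ∈ Set.Icc (-(n : ℤ)) n := by
    intro x hx
    rw [Set.mem_Icc] at hx ⊢
    by_cases h0 : x = 0
    · rw [h0, hw0]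
      omega
    · have := hw x h0
      have := h1 x.natAbs (by omega) (by omega)
      omega
  have hinj : ∀ x ∈ Set.Icc (-(n : ℤ)) n, ∀ y ∈ Set.Icc (-(n : ℤ)) n, w x = w y → x = y := by
    intro x hx y hy hxy
    rw [Set.mem_Icc] at hx hy
    by_cases hx0 : x = 0
    · by_contra hne
      have := hw y (by omega)
      have := h1 y.natAbs (by omega) (by omega)
      rw [hx0, hw0] at hxy
      omega
    by_cases hy0 : y = 0
    · have := hw x hx0
      have := h1 x.natAbs (by omega) (by omega)
      rw [hy0, hw0] at hxy
      omega
    have e : x.natAbs = y.natAbs := by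
      refine h2 _ _ (by omega) (by omega) (by omega) (by omega) ?_
      rw [← hw x hx0, ← hw y hy0, hxy]
    rcases Int.natAbs_eq_natAbs_iff.1 e with h | h
    · exact h
    · rw [h, hneg] at hxy
      have := hw y hy0
      have := h1 y.natAbs (by omega) (by omega)
      omega
  let f : Set.Icc (-(n : ℤ)) (n : ℤ) → Set.Icc (-(n : ℤ)) (n : ℤ) := fun x => ⟨w x.1, hmem _ x.2⟩
  have hf : Function.Injective f := fun x y hxy =>
    Subtype.ext (hinj _ x.2 _ y.2 (congrArg Subtype.val hxy))
  refine ⟨⟨Equiv.ofBijective f (Finite.injective_iff_bijective.1 hf), ?_⟩, ?_⟩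
  · intro i j hij
    change w j = -w i
    rw [hij, hneg]
  · intro i hi hin
    rw [val_eq _ hin]
    change w i = v i
    have hi' : 0 < (i : ℤ) := by omega
    simp only [w, Int.sign_eq_one_of_pos hi', one_mul, Int.natAbs_natCast]

end SignedPerm

/-! ### The structure of signed arc permutations -/

theorem ZMod.natCast_inj_of_lt {n a b : ℕ} (ha : a < n) (hb : b < n)
    (h : (a : ZMod n) = (b : ZMod n)) : a = b := by
  rw [ZMod.natCast_eq_natCast_iff] at h
  exact h.eq_of_lt_of_lt ha hb

theorem ZMod.exists_natCast_lt {n : ℕ} [NeZero n] (x : ZMod n) : ∃ t < n, x = (t : ZMod n) :=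
  ⟨x.val, x.val_lt, (ZMod.natCast_zmod_val x).symm⟩

/-- The number of positive entries before position `j`. -/
def ups (ε : ℕ → Bool) (j : ℕ) : ℕ :=
  Nat.count (fun l => ε l = true) j

/-- The number of negative entries before position `j`. -/
def downs (ε : ℕ → Bool) (j : ℕ) : ℕ :=
  Nat.count (fun l => ε l = false) j

theorem ups_succ_true {ε : ℕ → Bool} {j : ℕ} (h : ε j = true) : ups ε (j + 1) = ups ε j + 1 := by
  simp [ups, Nat.count_succ, h]

theorem ups_succ_false {ε : ℕ → Bool} {j : ℕ} (h : ε j = false) : ups ε (j + 1) = ups ε j := by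
  simp [ups, Nat.count_succ, h]

theorem downs_succ_true {ε : ℕ → Bool} {j : ℕ} (h : ε j = true) :
    downs ε (j + 1) = downs ε j := by
  simp [downs, Nat.count_succ, h]

theorem downs_succ_false {ε : ℕ → Bool} {j : ℕ} (h : ε j = false) :
    downs ε (j + 1) = downs ε j + 1 := by
  simp [downs, Nat.count_succ, h]

theorem ups_add_downs (ε : ℕ → Bool) (j : ℕ) : ups ε j + downs ε j = j := by
  induction j with
  | zero => rfl
  | succ j ih =>
    cases h : ε j
    · rw [ups_succ_false h, downs_succ_false h]
      omega
    · rw [ups_succ_true h, downs_succ_true h]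
      omega

/-- The residues of the absolute values of the signed arc permutation with sign sequence `ε` whose
positive values start after `g` and whose negative values start at `g`. -/
def arcWord (n : ℕ) (ε : ℕ → Bool) (g : ZMod n) (j : ℕ) : ZMod n :=
  if ε j = true then g + 1 + (ups ε j : ZMod n) else g - (downs ε j : ZMod n)

theorem arcWord_of_true {n : ℕ} {ε : ℕ → Bool} {g : ZMod n} {j : ℕ} (h : ε j = true) :
    arcWord n ε g j = g + 1 + (ups ε j : ZMod n) := by
  rw [arcWord, if_pos h]

theorem arcWord_of_false {n : ℕ} {ε : ℕ → Bool} {g : ZMod n} {j : ℕ} (h : ε j = false) :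
    arcWord n ε g j = g - (downs ε j : ZMod n) := by
  rw [arcWord, if_neg (by simp [h])]

/-- The first j entries occupy the cyclic interval from g - downs + 1 to g + ups: a positive entry
extends it at its upper end, a negative one at its lower end. -/
theorem mem_arc_iff {n : ℕ} {ε : ℕ → Bool} {g : ZMod n} {j : ℕ} {x : ZMod n} :
    (∃ l < j, x = arcWord n ε g l) ↔
      ∃ t : ℕ, t < j ∧ x = g - (downs ε j : ZMod n) + 1 + (t : ZMod n) := by
  induction j with
  | zero => simp
  | succ j ih =>
    have h1 : (∃ l < j + 1, x = arcWord n ε g l) ↔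
        (∃ l < j, x = arcWord n ε g l) ∨ x = arcWord n ε g j := by
      constructor
      · rintro ⟨l, hl, rfl⟩
        rcases (Nat.lt_succ_iff.1 hl).lt_or_eq with hl | rfl
        · exact Or.inl ⟨l, hl, rfl⟩
        · exact Or.inr rfl
      · rintro (⟨l, hl, rfl⟩ | rfl)
        · exact ⟨l, by omega, rfl⟩
        · exact ⟨j, by omega, rfl⟩
    rw [h1, ih]
    have hud : (ups ε j : ZMod n) + (downs ε j : ZMod n) = (j : ZMod n) := by
      rw [← Nat.cast_add, ups_add_downs]
    cases h : ε j with
    | true =>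
      rw [downs_succ_true h, arcWord_of_true h]
      constructor
      · rintro (⟨t, ht, rfl⟩ | rfl)
        · exact ⟨t, by omega, rfl⟩
        · exact ⟨j, by omega, by rw [← hud]; ring⟩
      · rintro ⟨t, ht, rfl⟩
        rcases (Nat.lt_succ_iff.1 ht).lt_or_eq with ht | rfl
        · exact Or.inl ⟨t, ht, rfl⟩
        · exact Or.inr (by rw [← hud]; ring)
    | false =>
      rw [downs_succ_false h, arcWord_of_false h]
      constructor
      · rintro (⟨t, ht, rfl⟩ | rfl)
        · exact ⟨t + 1, by omega, by push_cast; ring⟩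
        · exact ⟨0, by omega, by push_cast; ring⟩
      · rintro ⟨t, ht, rfl⟩
        cases t with
        | zero => exact Or.inr (by push_cast; ring)
        | succ t => exact Or.inl ⟨t, by omega, by push_cast; ring⟩

/-- As long as j < n, the next entry lies just outside the interval of the preceding ones. -/
theorem arcWord_injOn {n : ℕ} {ε : ℕ → Bool} {g : ZMod n} {i j : ℕ} (hij : i < j) (hj : j < n) :
    arcWord n ε g i ≠ arcWord n ε g j := by
  intro he
  obtain ⟨t, ht, h⟩ := mem_arc_iff.1 ⟨i, hij, he.symm⟩
  have hud : (ups ε j : ZMod n) + (downs ε j : ZMod n) = (j : ZMod n) := by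
    rw [← Nat.cast_add, ups_add_downs]
  cases hε : ε j with
  | true =>
    rw [arcWord_of_true hε] at h
    have : ((j : ℕ) : ZMod n) = (t : ZMod n) := by
      rw [← hud]
      linear_combination h
    have := ZMod.natCast_inj_of_lt hj (by omega) this
    omega
  | false =>
    rw [arcWord_of_false hε] at h
    have : ((t + 1 : ℕ) : ZMod n) = ((0 : ℕ) : ZMod n) := by
      push_cast
      linear_combination -h
    have := ZMod.natCast_inj_of_lt (by omega) (by omega) this
    omega

namespace SignedPerm

variable {n : ℕ}

/-- The sign sequence of a signed permutation. -/
def signs (π : SignedPerm n) (j : ℕ) : Bool :=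
  decide (0 < π.val (j + 1))

theorem signs_eq_true {π : SignedPerm n} {j : ℕ} : π.signs j = true ↔ 0 < π.val (j + 1) := by
  simp [signs]

theorem signs_eq_false {π : SignedPerm n} {j : ℕ} (hj : j < n) :
    π.signs j = false ↔ π.val (j + 1) < 0 := by
  have := π.one_le_natAbs_val (i := j + 1) (by omega) (by omega)
  simp only [signs, decide_eq_false_iff_not]
  omega

theorem absMod_injOn (π : SignedPerm n) {i j : ℕ} (hi : 1 ≤ i) (hin : i ≤ n) (hj : 1 ≤ j)
    (hjn : j ≤ n) (h : π.absMod i = π.absMod j) : i = j := by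
  refine π.natAbs_val_injOn hin hjn ?_
  have h1 := π.one_le_natAbs_val hi hin
  have h2 := π.one_le_natAbs_val hj hjn
  have h3 := π.natAbs_val_le hin
  have h4 := π.natAbs_val_le hjn
  have : (((π.val i).natAbs - 1 : ℕ) : ZMod n) = (((π.val j).natAbs - 1 : ℕ) : ZMod n) := by
    rw [Nat.cast_sub h1, Nat.cast_sub h2]
    exact congrArg (· - _) h
  have := ZMod.natCast_inj_of_lt (by omega) (by omega) this
  omega

theorem mem_prefixSet_succ {π : SignedPerm n} {j : ℕ} {x : ZMod n} :
    x ∈ π.prefixSet (j + 1) ↔ ∃ l < j, x = π.absMod (l + 1) := by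
  constructor
  · rintro ⟨l, h1, h2, rfl⟩
    exact ⟨l - 1, by omega, by rw [Nat.sub_add_cancel h1]⟩
  · rintro ⟨l, hl, rfl⟩
    exact ⟨l + 1, by omega, by omega, rfl⟩

theorem mem_prefixSet_succ_of_arc {π : SignedPerm n} {g : ZMod n} {j : ℕ}
    (h : ∀ l < j, π.absMod (l + 1) = arcWord n π.signs g l) {x : ZMod n} :
    x ∈ π.prefixSet (j + 1) ↔
      ∃ t : ℕ, t < j ∧ x = g - (downs π.signs j : ZMod n) + 1 + (t : ZMod n) := by
  rw [mem_prefixSet_succ, ← mem_arc_iff]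
  constructor <;>
  · rintro ⟨l, hl, rfl⟩
    exact ⟨l, hl, by rw [h l hl]⟩

end SignedPerm

/-- A cyclic interval with at least two elements contains a neighbour of each of its elements. -/
theorem IsCyclicInterval.exists_neighbour {n : ℕ} {S : Set (ZMod n)} (h : IsCyclicInterval S)
    {x y : ZMod n} (hx : x ∈ S) (hy : y ∈ S) (hne : x ≠ y) : x - 1 ∈ S ∨ x + 1 ∈ S := by
  obtain ⟨a, k, rfl⟩ := h
  obtain ⟨t, ht, rfl⟩ := hx
  obtain ⟨u, hu, rfl⟩ := hy
  by_cases h1 : t + 1 < k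
  · exact Or.inr ⟨t + 1, h1, by push_cast; ring⟩
  · cases t with
    | zero =>
      exfalso
      apply hne
      rw [(by omega : u = 0)]
    | succ t => exact Or.inl ⟨t, by omega, by push_cast; ring⟩

/-- The prefixes are growing intervals, so each new entry is adjacent to one end of the previous
interval, and the sign conditions say which sign belongs to which end. For the last entry both ends
are the same residue, which is why its sign is free. -/
theorem IsSignedArc.exists_arcWord {n : ℕ} [NeZero n] {π : SignedPerm n} (hπ : IsSignedArc π) :
    ∃ g : ZMod n, ∀ j < n, π.absMod (j + 1) = arcWord n π.signs g j := by
  refine ⟨if π.signs 0 = true then π.absMod 1 - 1 else π.absMod 1, fun j => ?_⟩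
  induction j using Nat.strong_induction_on with
  | _ j ih =>
    intro hj
    set g := if π.signs 0 = true then π.absMod 1 - 1 else π.absMod 1 with hg
    rcases Nat.eq_zero_or_pos j with rfl | hj0
    · cases h : π.signs 0 with
      | true =>
        rw [arcWord_of_true h, hg, if_pos h]
        simp [ups]
      | false =>
        rw [arcWord_of_false h, hg, if_neg (by simp [h])]
        simp [downs]
    have hP := fun x => π.mem_prefixSet_succ_of_arc (g := g) (j := j) (x := x)
      fun l hl => ih l hl (by omega)
    have hud : (ups π.signs j : ZMod n) + (downs π.signs j : ZMod n) = (j : ZMod n) := by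
      rw [← Nat.cast_add, ups_add_downs]
    have hnot : π.absMod (j + 1) ∉ π.prefixSet (j + 1) := by
      rw [SignedPerm.mem_prefixSet_succ]
      rintro ⟨l, hl, h⟩
      have := π.absMod_injOn (by omega) (by omega) (by omega) (by omega) h
      omega
    obtain ⟨t, htn, ht⟩ :=
      ZMod.exists_natCast_lt (π.absMod (j + 1) - (g - (downs π.signs j : ZMod n) + 1))
    have ht : π.absMod (j + 1) = g - (downs π.signs j : ZMod n) + 1 + (t : ZMod n) := by
      rw [← ht]
      ring
    have hjt : j ≤ t := by
      by_contra! hlt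
      exact hnot ((hP _).2 ⟨t, hlt, ht⟩)
    -- Offset j is just above the interval and offset n - 1 just below it. If at most two residues
    -- are left, there is nothing else; otherwise the next prefix is again an interval, and the new
    -- entry has a neighbour in it.
    have hends : t = j ∨ t + 1 = n := by
      by_cases hjn : j + 2 < n
      · have hint := (hπ (j + 2) (by omega) hjn).1
        have hz : π.absMod (j + 1) ∈ π.prefixSet (j + 2) :=
          SignedPerm.mem_prefixSet_succ.2 ⟨j, by omega, rfl⟩
        have hz0 : π.absMod 1 ∈ π.prefixSet (j + 2) :=
          SignedPerm.mem_prefixSet_succ.2 ⟨0, by omega, rfl⟩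
        have hne : π.absMod (j + 1) ≠ π.absMod 1 := by
          intro h
          have := π.absMod_injOn (by omega) (by omega) (by omega) (by omega) h
          omega
        have hshrink : ∀ x, x ≠ π.absMod (j + 1) → x ∈ π.prefixSet (j + 2) →
            x ∈ π.prefixSet (j + 1) := by
          intro x hx hxP
          obtain ⟨l, hl, rfl⟩ := SignedPerm.mem_prefixSet_succ.1 hxP
          rcases (Nat.lt_succ_iff.1 hl).lt_or_eq with hl | rfl
          · exact SignedPerm.mem_prefixSet_succ.2 ⟨l, hl, rfl⟩
          · exact absurd rfl hx
        have h10 : (1 : ZMod n) ≠ 0 := by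
          intro h
          have : ((1 : ℕ) : ZMod n) = ((0 : ℕ) : ZMod n) := by exact_mod_cast h
          have := ZMod.natCast_inj_of_lt (by omega) (by omega) this
          omega
        rcases hint.exists_neighbour hz hz0 hne with h | h
        · obtain ⟨u, hu, he⟩ := (hP _).1 (hshrink _ (by simpa using h10) h)
          have : (t : ZMod n) = ((u + 1 : ℕ) : ZMod n) := by
            push_cast
            linear_combination he - ht
          have := ZMod.natCast_inj_of_lt htn (by omega) this
          omega
        · obtain ⟨u, hu, he⟩ := (hP _).1 (hshrink _ (by simpa using h10) h)
          have : ((t + 1 : ℕ) : ZMod n) = (u : ZMod n) := by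
            push_cast
            linear_combination he - ht
          by_contra! hcon
          have := ZMod.natCast_inj_of_lt (by omega) (by omega) this
          omega
      · omega
    have hlast : t + 1 = n → (t : ZMod n) + 1 = 0 := by
      intro h
      have : ((t + 1 : ℕ) : ZMod n) = 0 := by rw [h, ZMod.natCast_self]
      exact_mod_cast this
    have htrue : t = j → π.absMod (j + 1) = g + 1 + (ups π.signs j : ZMod n) := by
      rintro rfl
      rw [ht, ← hud]
      ring
    have hfalse : t + 1 = n → π.absMod (j + 1) = g - (downs π.signs j : ZMod n) := by
      intro h
      rw [ht]
      linear_combination hlast h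
    by_cases hjn : j + 1 = n
    · cases h : π.signs j with
      | true => rw [arcWord_of_true h, htrue (by omega)]
      | false => rw [arcWord_of_false h, hfalse (by omega)]
    · obtain ⟨-, hpos, hneg⟩ := hπ (j + 1) (by omega) (by omega)
      rcases hends with h | h
      · have : π.signs j = true := by
          rw [SignedPerm.signs_eq_true]
          refine hpos ((hP _).2 ⟨j - 1, by omega, ?_⟩)
          rw [ht, h, Nat.cast_sub hj0]
          push_cast
          ring
        rw [arcWord_of_true this, htrue h]
      · have : π.signs j = false := by
          rw [SignedPerm.signs_eq_false hj]
          refine hneg ((hP _).2 ⟨0, by omega, ?_⟩)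
          rw [ht, Nat.cast_zero]
          linear_combination hlast h
        rw [arcWord_of_false this, hfalse h]

/-- A wrong sign would place a neighbour of the new entry at the opposite end of the interval, which
for i < n is too short to close up the circle. -/
theorem isSignedArc_of_arcWord {n : ℕ} {π : SignedPerm n} {g : ZMod n}
    (h : ∀ j < n, π.absMod (j + 1) = arcWord n π.signs g j) : IsSignedArc π := by
  intro i hi hin
  obtain ⟨j, rfl⟩ : ∃ j, i = j + 1 := ⟨i - 1, by omega⟩
  have hP := fun x => π.mem_prefixSet_succ_of_arc (g := g) (j := j) (x := x)
    fun l hl => h l (by omega)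
  have hud : (ups π.signs j : ZMod n) + (downs π.signs j : ZMod n) = (j : ZMod n) := by
    rw [← Nat.cast_add, ups_add_downs]
  refine ⟨⟨_, j, Set.ext hP⟩, ?_, ?_⟩
  · intro hm
    obtain ⟨t, ht, he⟩ := (hP _).1 hm
    rw [← SignedPerm.signs_eq_true]
    by_contra hε
    rw [Bool.not_eq_true] at hε
    rw [h j (by omega), arcWord_of_false hε] at he
    have : ((t + 2 : ℕ) : ZMod n) = ((0 : ℕ) : ZMod n) := by
      push_cast
      linear_combination -he
    have := ZMod.natCast_inj_of_lt (by omega) (by omega) this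
    omega
  · intro hm
    obtain ⟨t, ht, he⟩ := (hP _).1 hm
    rw [← SignedPerm.signs_eq_false (by omega)]
    by_contra hε
    rw [Bool.not_eq_false] at hε
    rw [h j (by omega), arcWord_of_true hε] at he
    have : ((j + 1 : ℕ) : ZMod n) = (t : ZMod n) := by
      push_cast
      rw [← hud]
      linear_combination he
    have := ZMod.natCast_inj_of_lt (by omega) (by omega) this
    omega

/-! ### Marking the entry with absolute value one -/

theorem ups_congr {ε ε' : ℕ → Bool} {j : ℕ} (h : ∀ l < j, ε l = ε' l) : ups ε j = ups ε' j := by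
  rw [ups, ups, Nat.count_eq_card_filter_range, Nat.count_eq_card_filter_range]
  congr 1
  exact filter_congr fun l hl => by rw [h l (mem_range.1 hl)]

theorem downs_congr {ε ε' : ℕ → Bool} {j : ℕ} (h : ∀ l < j, ε l = ε' l) :
    downs ε j = downs ε' j := by
  rw [downs, downs, Nat.count_eq_card_filter_range, Nat.count_eq_card_filter_range]
  congr 1
  exact filter_congr fun l hl => by rw [h l (mem_range.1 hl)]

theorem arcWord_congr {n : ℕ} {ε ε' : ℕ → Bool} {g : ZMod n} {j : ℕ} (h : ∀ l ≤ j, ε l = ε' l) :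
    arcWord n ε g j = arcWord n ε' g j := by
  rw [arcWord, arcWord, h j le_rfl, ups_congr fun l hl => h l hl.le,
    downs_congr fun l hl => h l hl.le]

/-- The offset of the arc word with a `1` in position `i`. -/
def arcOffset (n : ℕ) (ε : ℕ → Bool) (i : ℕ) : ZMod n :=
  if ε i = true then -(ups ε i : ZMod n) else 1 + (downs ε i : ZMod n)

theorem arcWord_eq_one_iff {n : ℕ} {ε : ℕ → Bool} {g : ZMod n} {i : ℕ} :
    arcWord n ε g i = 1 ↔ g = arcOffset n ε i := by
  rw [arcWord, arcOffset]
  split_ifs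
  · constructor <;> intro h <;> linear_combination h
  · constructor <;> intro h <;> linear_combination h

namespace SignedPerm

variable {n : ℕ}

theorem natAbs_val_eq_one_iff (π : SignedPerm n) {j : ℕ} (hj : j < n) :
    (π.val (j + 1)).natAbs = 1 ↔ π.absMod (j + 1) = 1 := by
  have h1 := π.one_le_natAbs_val (i := j + 1) (by omega) (by omega)
  have h2 := π.natAbs_val_le (i := j + 1) (by omega)
  constructor
  · intro h
    rw [absMod, h, Nat.cast_one]
  · intro h
    have : (((π.val (j + 1)).natAbs - 1 : ℕ) : ZMod n) = ((0 : ℕ) : ZMod n) := by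
      rw [Nat.cast_sub h1, Nat.cast_one, Nat.cast_zero, sub_eq_zero]
      exact h
    have := ZMod.natCast_inj_of_lt (by omega) (by omega) this
    omega

theorem exists_natAbs_val_eq_one (π : SignedPerm n) (hn : 1 ≤ n) :
    ∃ i : Fin n, (π.val (i + 1)).natAbs = 1 := by
  let f : Fin n → Fin n := fun j => ⟨(π.val (j + 1)).natAbs - 1, by
    have h1 := π.one_le_natAbs_val (i := j + 1) (by omega) (by omega)
    have h2 := π.natAbs_val_le (i := j + 1) (by omega)
    omega⟩
  have hf : Function.Injective f := by
    intro i j h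
    have h := congrArg Fin.val h
    simp only [f] at h
    have h1 := π.one_le_natAbs_val (i := j + 1) (by omega) (by omega)
    have h2 := π.one_le_natAbs_val (i := i + 1) (by omega) (by omega)
    have := π.natAbs_val_injOn (i := i + 1) (j := j + 1) (by omega) (by omega) (by omega)
    exact Fin.ext (by omega)
  obtain ⟨i, hi⟩ := Finite.injective_iff_surjective.1 hf ⟨0, hn⟩
  have hi := congrArg Fin.val hi
  simp only [f] at hi
  have h1 := π.one_le_natAbs_val (i := i + 1) (by omega) (by omega)
  exact ⟨i, by omega⟩

theorem absMod_eq_arcWord {π : SignedPerm n} [NeZero n] (hπ : IsSignedArc π) {i : ℕ} (hi : i < n)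
    (h1 : (π.val (i + 1)).natAbs = 1) :
    ∀ j < n, π.absMod (j + 1) = arcWord n π.signs (arcOffset n π.signs i) j := by
  obtain ⟨g, hg⟩ := hπ.exists_arcWord
  rw [π.natAbs_val_eq_one_iff hi, hg i hi, arcWord_eq_one_iff] at h1
  rwa [← h1]

/-- The position of ±1 determines the offset g, and g with the signs determines all residues, hence
all values. -/
theorem eq_of_signs_eq [NeZero n] {π π' : SignedPerm n} (hπ : IsSignedArc π)
    (hπ' : IsSignedArc π') (hs : ∀ j < n, π.signs j = π'.signs j) {i : ℕ} (hi : i < n)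
    (h1 : (π.val (i + 1)).natAbs = 1) (h1' : (π'.val (i + 1)).natAbs = 1) : π = π' := by
  have hoff : arcOffset n π.signs i = arcOffset n π'.signs i := by
    rw [arcOffset, arcOffset, hs i hi, ups_congr fun l hl => hs l (by omega),
      downs_congr fun l hl => hs l (by omega)]
  refine ext_val fun k hk hkn => ?_
  obtain ⟨j, rfl⟩ : ∃ j, k = j + 1 := ⟨k - 1, by omega⟩
  have e : π.absMod (j + 1) = π'.absMod (j + 1) := by
    rw [absMod_eq_arcWord hπ hi h1 j (by omega), absMod_eq_arcWord hπ' hi h1' j (by omega), hoff]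
    exact arcWord_congr fun l hl => hs l (by omega)
  have a1 := π.one_le_natAbs_val hk hkn
  have a2 := π'.one_le_natAbs_val hk hkn
  have a3 := π.natAbs_val_le hkn
  have a4 := π'.natAbs_val_le hkn
  have : (((π.val (j + 1)).natAbs - 1 : ℕ) : ZMod n) =
      (((π'.val (j + 1)).natAbs - 1 : ℕ) : ZMod n) := by
    rw [Nat.cast_sub a1, Nat.cast_sub a2]
    exact congrArg (· - _) e
  have habs := ZMod.natCast_inj_of_lt (by omega) (by omega) this
  have hsj := hs j (by omega)
  have hiff : 0 < π.val (j + 1) ↔ 0 < π'.val (j + 1) := by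
    rw [← signs_eq_true, ← signs_eq_true, hsj]
  omega

theorem exists_signedArc [NeZero n] (ε : ℕ → Bool) {i : ℕ} (hi : i < n) :
    ∃ π : SignedPerm n, IsSignedArc π ∧ (∀ j < n, π.signs j = ε j) ∧
      (π.val (i + 1)).natAbs = 1 := by
  set z : ℕ → ZMod n := arcWord n ε (arcOffset n ε i) with hz
  -- The shift by 1 selects the representative of each residue in 1, …, n instead of 0, …, n - 1.
  let v : ℕ → ℤ := fun k =>
    if ε (k - 1) = true then ((z (k - 1) - 1).val + 1 : ℤ) else -((z (k - 1) - 1).val + 1 : ℤ)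
  have hv : ∀ j, (v (j + 1)).natAbs = (z j - 1).val + 1 := by
    intro j
    simp only [v, Nat.add_sub_cancel]
    split_ifs <;> omega
  obtain ⟨π, hπ⟩ := exists_val_eq (n := n) (v := v)
    (by
      intro k hk hkn
      obtain ⟨j, rfl⟩ : ∃ j, k = j + 1 := ⟨k - 1, by omega⟩
      rw [hv]
      have := (z j - 1).val_lt
      omega)
    (by
      intro k k' hk hkn hk' hkn' h
      obtain ⟨j, rfl⟩ : ∃ j, k = j + 1 := ⟨k - 1, by omega⟩
      obtain ⟨j', rfl⟩ : ∃ j, k' = j + 1 := ⟨k' - 1, by omega⟩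
      rw [hv, hv, Nat.add_right_cancel_iff] at h
      have h := sub_left_injective (ZMod.val_injective n h)
      rcases lt_trichotomy j j' with hlt | rfl | hlt
      · exact absurd h (arcWord_injOn hlt (by omega))
      · rfl
      · exact absurd h.symm (arcWord_injOn hlt (by omega)))
  have hsigns : ∀ j < n, π.signs j = ε j := by
    intro j hj
    rw [signs, hπ (j + 1) (by omega) (by omega)]
    cases h : ε j
    · simp only [v, Nat.add_sub_cancel, h]
      simp only [Bool.false_eq_true, if_false, decide_eq_false_iff_not]
      omega
    · simp only [v, Nat.add_sub_cancel, h]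
      simp only [if_true, decide_eq_true_eq]
      omega
  have hmod : ∀ j < n, π.absMod (j + 1) = z j := by
    intro j hj
    rw [absMod, hπ (j + 1) (by omega) (by omega), hv]
    push_cast
    rw [ZMod.natCast_zmod_val]
    ring
  refine ⟨π, isSignedArc_of_arcWord (g := arcOffset n ε i) fun j hj => ?_, hsigns, ?_⟩
  · rw [hmod j hj, hz]
    exact arcWord_congr fun l hl => (hsigns l (by omega)).symm
  · rw [natAbs_val_eq_one_iff π hi, hmod i hi, hz, arcWord_eq_one_iff]

end SignedPerm

theorem ZMod.succ_cases {n a b : ℕ} (ha : 1 ≤ a) (han : a ≤ n) (hb : 1 ≤ b) (hbn : b ≤ n)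
    (h : (b : ZMod n) = (a : ZMod n) + 1) : b = a + 1 ∨ a = n ∧ b = 1 := by
  have h : ((b - 1 : ℕ) : ZMod n) = (a : ZMod n) := by
    rw [Nat.cast_sub hb, Nat.cast_one]
    linear_combination h
  rcases han.lt_or_eq with hlt | rfl
  · have := ZMod.natCast_inj_of_lt (by omega) hlt h
    omega
  · rw [ZMod.natCast_self] at h
    have := ZMod.natCast_inj_of_lt (n := a) (a := b - 1) (b := 0) (by omega) (by omega) (by simpa using h)
    omega

/-- The descents of a signed arc permutation between its entries. -/
theorem IsSignedArc.not_descent_iff {n : ℕ} [NeZero n] {π : SignedPerm n} (hπ : IsSignedArc π)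
    {i j : ℕ} (hi : i < n) (h1 : (π.val (i + 1)).natAbs = 1) (hj : j + 1 < n) :
    ¬ π.val (j + 1 + 1) < π.val (j + 1) ↔ π.signs j ≤ π.signs (j + 1) ∧
      (π.signs j = π.signs (j + 1) →
        (π.signs j = true → i ≠ j + 1) ∧ (π.signs j = false → i ≠ j)) := by
  obtain ⟨g, hg⟩ := hπ.exists_arcWord
  have a1 := π.one_le_natAbs_val (i := j + 1) (by omega) (by omega)
  have a2 := π.one_le_natAbs_val (i := j + 1 + 1) (by omega) (by omega)
  have a3 := π.natAbs_val_le (i := j + 1) (by omega)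
  have a4 := π.natAbs_val_le (i := j + 1 + 1) (by omega)
  have hz := hg j (by omega)
  have hz' := hg (j + 1) (by omega)
  have hmark : ∀ l < n, (π.val (l + 1)).natAbs = 1 ↔ i = l := by
    intro l hl
    constructor
    · intro h
      have := π.natAbs_val_injOn (i := i + 1) (j := l + 1) (by omega) (by omega) (h1.trans h.symm)
      omega
    · rintro rfl
      exact h1
  have m1 := hmark j (by omega)
  have m2 := hmark (j + 1) hj
  -- Along negative entries the absolute value drops by 1 cyclically, so the only descent is from -1
  -- to -n, at i = j. Along positive entries it rises by 1, so the only descent is from n to 1, at i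
  -- = j + 1.
  cases hs : π.signs j <;> cases hs' : π.signs (j + 1)
  · rw [arcWord_of_false hs] at hz
    rw [arcWord_of_false hs', downs_succ_false hs] at hz'
    rw [SignedPerm.signs_eq_false (by omega)] at hs hs'
    have := ZMod.succ_cases a2 a4 a1 a3 (by
      change π.absMod (j + 1) = π.absMod (j + 1 + 1) + 1
      rw [hz, hz']
      push_cast
      ring)
    simp only [le_refl, true_and, forall_const, Bool.false_eq_true, false_imp_iff, Ne]
    omega
  · rw [SignedPerm.signs_eq_false (by omega)] at hs
    rw [SignedPerm.signs_eq_true] at hs'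
    simp only [Bool.false_le, Bool.false_eq_true, false_imp_iff, and_true, iff_true]
    omega
  · rw [SignedPerm.signs_eq_false (by omega)] at hs'
    rw [SignedPerm.signs_eq_true] at hs
    refine iff_of_false (by omega) fun h => absurd h.1 (by decide)
  · rw [arcWord_of_true hs] at hz
    rw [arcWord_of_true hs', ups_succ_true hs] at hz'
    rw [SignedPerm.signs_eq_true] at hs hs'
    have := ZMod.succ_cases a1 a3 a2 a4 (by
      change π.absMod (j + 1 + 1) = π.absMod (j + 1) + 1
      rw [hz, hz']
      push_cast
      ring)
    simp only [le_refl, true_and, forall_const, Bool.true_eq_false, false_imp_iff, Ne, and_true]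
    omega

/-! ### Sorted words of signed letters -/

/-- The position `i` is the first occurrence of a positive letter, or the last occurrence of a
negative letter, in the word `t`. -/
def IsExtremal {n : ℕ} (t : Fin n → ℕ ×ₗ Bool) (i : Fin n) : Prop :=
  ((ofLex (t i)).2 = true → ∀ j, j < i → t j ≠ t i) ∧
    ((ofLex (t i)).2 = false → ∀ j, i < j → t j ≠ t i)

/-- Equal letters of a sorted word are contiguous, so only neighbouring positions matter. This
matches the local form of the descent conditions. -/
theorem isExtremal_iff_of_monotone {N : ℕ} {t : Fin (N + 1) → ℕ ×ₗ Bool} (ht : Monotone t)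
    {i : Fin (N + 1)} : IsExtremal t i ↔ ∀ j : Fin N, t j.castSucc = t j.succ →
      ((ofLex (t j.castSucc)).2 = true → i ≠ j.succ) ∧
      ((ofLex (t j.castSucc)).2 = false → i ≠ j.castSucc) := by
  constructor
  · rintro ⟨h1, h2⟩ j hj
    constructor
    · rintro hc rfl
      exact h1 (hj ▸ hc) _ (Fin.castSucc_lt_succ) hj
    · rintro hc rfl
      exact h2 hc _ (Fin.castSucc_lt_succ) hj.symm
  · intro h
    constructor
    · intro hc j hji he
      obtain ⟨k, rfl⟩ : ∃ k, i = Fin.succ k :=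
        ⟨i.pred (Fin.ne_zero_of_lt hji), (Fin.succ_pred _ _).symm⟩
      have e : t k.castSucc = t k.succ :=
        le_antisymm (ht Fin.castSucc_lt_succ.le) (he ▸ ht (Fin.le_castSucc_iff.2 hji))
      exact (h k e).1 (e ▸ hc) rfl
    · intro hc j hij he
      obtain ⟨k, rfl⟩ : ∃ k, i = Fin.castSucc k :=
        ⟨i.castPred (Fin.ne_last_of_lt hij), (Fin.castSucc_castPred _ _).symm⟩
      have e : t k.castSucc = t k.succ :=
        le_antisymm (ht Fin.castSucc_lt_succ.le) (he ▸ ht (Fin.castSucc_lt_iff_succ_le.1 hij))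
      exact (h k e).2 hc rfl

/-- The sequences in Chow's quasisymmetric function of a signed arc permutation are the sorted words
of signed letters in which the marked position is extremal. -/
theorem chow_condition_iff {N : ℕ} {π : SignedPerm (N + 1)} (hπ : IsSignedArc π)
    {i : Fin (N + 1)} (hi : (π.val (i + 1)).natAbs = 1) {s : Fin (N + 2) → ℕ} (hs0 : s 0 = 0)
    {t : Fin (N + 1) → ℕ ×ₗ Bool} (ht : ∀ j, t j = toLex (s j.succ, π.signs j)) :
    (Monotone s ∧ ∀ j : Fin (N + 1), (j : ℕ) ∈ π.des → s j.castSucc < s j.succ) ↔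
      Monotone t ∧ (∀ j, t j ≠ toLex (0, false)) ∧ IsExtremal t i := by
  have h1 : (Monotone s ∧ ∀ j : Fin (N + 1), (j : ℕ) ∈ π.des → s j.castSucc < s j.succ) ↔
      ∀ j : Fin (N + 1), s j.castSucc ≤ s j.succ ∧
        ((j : ℕ) ∈ π.des → s j.castSucc < s j.succ) := by
    rw [Fin.monotone_iff_le_succ, ← forall_and]
  have h2 : (Monotone t ∧ (∀ j, t j ≠ toLex (0, false)) ∧ IsExtremal t i) ↔
      t 0 ≠ toLex (0, false) ∧ ∀ j : Fin N, t j.castSucc ≤ t j.succ ∧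
        (t j.castSucc = t j.succ → ((ofLex (t j.castSucc)).2 = true → i ≠ j.succ) ∧
        ((ofLex (t j.castSucc)).2 = false → i ≠ j.castSucc)) := by
    rw [forall_and, ← Fin.monotone_iff_le_succ]
    constructor
    · rintro ⟨hm, h0, he⟩
      exact ⟨h0 0, hm, (isExtremal_iff_of_monotone hm).1 he⟩
    · rintro ⟨h0, hm, he⟩
      -- The negative zero is the smallest letter, so it suffices to exclude it from the first
      -- position.
      refine ⟨hm, fun j hj => h0 ?_, (isExtremal_iff_of_monotone hm).2 he⟩
      have hle := hm (Fin.zero_le j)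
      rw [hj] at hle
      refine le_antisymm hle ?_
      rw [Prod.Lex.le_iff]
      simp only [ofLex_toLex]
      rcases Nat.eq_zero_or_pos (ofLex (t 0)).1 with h | h
      · exact Or.inr ⟨h.symm, Bool.false_le _⟩
      · exact Or.inl h
  rw [h1, h2, Fin.forall_fin_succ]
  refine and_congr ?_ (forall_congr' fun j => ?_)
  -- The descent at 0 occurs exactly when the first entry is negative, and then the first index must
  -- be positive: the first letter is not a negative zero.
  · have hv := π.one_le_natAbs_val (i := 1) le_rfl (by omega)
    have hdes : ((0 : Fin (N + 1)) : ℕ) ∈ π.des ↔ π.signs 0 = false := by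
      rw [SignedPerm.signs_eq_false (by omega), SignedPerm.des, mem_filter, mem_range]
      simp [π.val_zero]
    rw [hdes, ht 0]
    simp only [Fin.castSucc_zero, hs0, zero_le, true_and, Fin.val_zero, Ne,
      EmbeddingLike.apply_eq_iff_eq, Prod.mk.injEq, not_and]
    rw [imp_not_comm, Nat.pos_iff_ne_zero]
  · have hdes : ((j.succ : Fin (N + 1)) : ℕ) ∈ π.des ↔
        π.val (j + 1 + 1) < π.val (j + 1) := by
      rw [SignedPerm.des, mem_filter, mem_range, Fin.val_succ]
      exact and_iff_right (by omega)
    have hnd := hπ.not_descent_iff i.2 hi (j := j) (by omega)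
    have hi1 : i = j.succ ↔ (i : ℕ) = j + 1 := by rw [Fin.ext_iff, Fin.val_succ]
    have hi2 : i = j.castSucc ↔ (i : ℕ) = j := by rw [Fin.ext_iff, Fin.val_castSucc]
    rw [hdes, ht, ht, Prod.Lex.toLex_le_toLex]
    simp only [EmbeddingLike.apply_eq_iff_eq, Prod.mk.injEq, ofLex_toLex, Ne, hi1, hi2,
      Fin.val_castSucc, Fin.val_succ, Fin.succ_castSucc]
    by_cases hd : π.val (j + 1 + 1) < π.val (j + 1)
    · simp only [hd, not_true, false_iff, Ne] at hnd
      simp only [hd, true_imp_iff]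
      constructor
      · rintro ⟨-, h⟩
        exact ⟨Or.inl h, fun h' => absurd h'.1 h.ne⟩
      · rintro ⟨h | ⟨h, h'⟩, h''⟩
        · exact ⟨h.le, h⟩
        · exact absurd ⟨h', fun e => h'' ⟨h, e⟩⟩ hnd
    · simp only [hd, not_false_iff, true_iff, Ne] at hnd
      simp only [hd, false_imp_iff, and_true]
      constructor
      · intro h
        refine ⟨?_, fun h' => hnd.2 h'.2⟩
        rcases h.lt_or_eq with h | h
        · exact Or.inl h
        · exact Or.inr ⟨h, hnd.1⟩
      · rintro ⟨h | ⟨h, -⟩, -⟩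
        · exact h.le
        · exact h.le

/-- The content of the letters of sign `b` in the word `t`. -/
noncomputable def signContent {n : ℕ} (t : Fin n → ℕ ×ₗ Bool) (b : Bool) : ℕ →₀ ℕ :=
  ∑ j, if (ofLex (t j)).2 = b then Finsupp.single (ofLex (t j)).1 1 else 0

theorem signContent_apply {n : ℕ} (t : Fin n → ℕ ×ₗ Bool) (b : Bool) (k : ℕ) :
    signContent t b k = (univ.val.map t).count (toLex (k, b)) := by
  rw [signContent, Finsupp.finsetSum_apply, Multiset.count_map]
  change _ = (univ.filter fun j => toLex (k, b) = t j).card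
  rw [card_filter]
  refine sum_congr rfl fun j _ => ?_
  have : toLex (k, b) = t j ↔ (ofLex (t j)).2 = b ∧ (ofLex (t j)).1 = k := by
    rw [eq_comm, ← ofLex.injective.eq_iff, ofLex_toLex, Prod.ext_iff, and_comm]
  simp only [this]
  by_cases h : (ofLex (t j)).2 = b
  · simp [h, Finsupp.single_apply]
  · simp [h]

theorem signContent_add {n : ℕ} (t : Fin n → ℕ ×ₗ Bool) :
    signContent t false + signContent t true = ∑ j, Finsupp.single (ofLex (t j)).1 1 := by
  rw [signContent, signContent, ← sum_add_distrib]
  refine sum_congr rfl fun j _ => ?_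
  cases h : (ofLex (t j)).2 <;> simp

theorem signContent_ne_zero_iff {n : ℕ} {t : Fin n → ℕ ×ₗ Bool} {b : Bool} {k : ℕ} :
    signContent t b k ≠ 0 ↔ ∃ j, t j = toLex (k, b) := by
  rw [signContent_apply, Multiset.count_ne_zero, Multiset.mem_map]
  simp

theorem Monotone.eq_of_map_univ_eq {α : Type*} [LinearOrder α] {n : ℕ} {t t' : Fin n → α}
    (ht : Monotone t) (ht' : Monotone t') (h : univ.val.map t = univ.val.map t') : t = t' := by
  rw [Fin.univ_val_map, Fin.univ_val_map, Multiset.coe_eq_coe] at h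
  exact List.ofFn_injective (h.eq_of_pairwise' ht.sortedLE_ofFn.pairwise ht'.sortedLE_ofFn.pairwise)

theorem Multiset.exists_monotone_map_univ {α : Type*} [LinearOrder α] {n : ℕ} (M : Multiset α)
    (hM : M.card = n) : ∃ t : Fin n → α, Monotone t ∧ univ.val.map t = M := by
  obtain ⟨l, rfl⟩ := Quot.exists_rep M
  change l.length = n at hM
  subst hM
  refine ⟨l.get ∘ Tuple.sort l.get, Tuple.monotone_sort _, ?_⟩
  rw [Fin.univ_val_map]
  refine (Multiset.coe_eq_coe.2 (Equiv.Perm.ofFn_comp_perm (Tuple.sort l.get) l.get)).trans ?_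
  rw [List.ofFn_get]
  rfl

/-- The sorted words of length `n` and content `m` in signed letters, without negative zeros. -/
abbrev SignedWord (n : ℕ) (m : ℕ →₀ ℕ) : Type :=
  {t : Fin n → ℕ ×ₗ Bool // Monotone t ∧ (∀ j, t j ≠ toLex (0, false)) ∧
    ∑ j, Finsupp.single (ofLex (t j)).1 1 = m}

theorem signContent_mem_signSplits {n : ℕ} {m : ℕ →₀ ℕ} (t : SignedWord n m) :
    (signContent t.1 false, signContent t.1 true) ∈ signSplits m := by
  rw [signSplits, mem_filter, HasAntidiagonal.mem_antidiagonal]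
  refine ⟨(signContent_add t.1).trans t.2.2.2, ?_⟩
  by_contra h
  obtain ⟨j, hj⟩ := signContent_ne_zero_iff.1 h
  exact t.2.2.1 j hj

/-- A sorted word is determined by its multiset of letters, that is, by its negative and positive
contents. -/
theorem bijective_signContent {n : ℕ} {m : ℕ →₀ ℕ} (hm : m.degree = n) :
    Function.Bijective fun t : SignedWord n m =>
      (⟨_, signContent_mem_signSplits t⟩ : signSplits m) := by
  constructor
  · intro t t' h
    have h := congrArg Subtype.val h
    simp only [Prod.mk.injEq] at h
    refine Subtype.ext (t.2.1.eq_of_map_univ_eq t'.2.1 (Multiset.ext.2 fun x => ?_))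
    obtain ⟨⟨k, b⟩, rfl⟩ := toLex.surjective x
    rw [← signContent_apply, ← signContent_apply]
    cases b
    · rw [h.1]
    · rw [h.2]
  · rintro ⟨⟨p, q⟩, hpq⟩
    rw [signSplits, mem_filter, HasAntidiagonal.mem_antidiagonal] at hpq
    simp only at hpq
    have hcard : ((Finsupp.toMultiset p).map (fun k => (toLex (k, false) : ℕ ×ₗ Bool)) +
        (Finsupp.toMultiset q).map (fun k => (toLex (k, true) : ℕ ×ₗ Bool))).card = n := by
      rw [Multiset.card_add, Multiset.card_map, Multiset.card_map, Finsupp.card_toMultiset,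
        Finsupp.card_toMultiset, ← hm, ← hpq.1, map_add]
      rfl
    obtain ⟨t, ht, hmap⟩ := Multiset.exists_monotone_map_univ _ hcard
    have hinj : ∀ b : Bool, Function.Injective fun k : ℕ => (toLex (k, b) : ℕ ×ₗ Bool) := by
      intro b k k' h
      exact congrArg Prod.fst (toLex.injective h)
    have hzero : ∀ (b b' : Bool) (k : ℕ) (f : ℕ →₀ ℕ), b ≠ b' →
        ((Finsupp.toMultiset f).map fun k => (toLex (k, b) : ℕ ×ₗ Bool)).count
          (toLex (k, b')) = 0 := by
      intro b b' k f hb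
      rw [Multiset.count_eq_zero, Multiset.mem_map]
      rintro ⟨k', -, h⟩
      exact hb (congrArg Prod.snd (toLex.injective h))
    have hp : signContent t false = p := by
      ext k
      rw [signContent_apply, hmap, Multiset.count_add, hzero true false k q (by decide),
        Multiset.count_map_eq_count' _ _ (hinj false), Finsupp.count_toMultiset, add_zero]
    have hq : signContent t true = q := by
      ext k
      rw [signContent_apply, hmap, Multiset.count_add, hzero false true k p (by decide),
        Multiset.count_map_eq_count' _ _ (hinj true), Finsupp.count_toMultiset, zero_add]
    refine ⟨⟨t, ht, ?_, ?_⟩, ?_⟩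
    · intro j hj
      have := signContent_ne_zero_iff.2 ⟨j, hj⟩
      rw [hp] at this
      exact this hpq.2
    · rw [← signContent_add, hp, hq, hpq.1]
    · exact Subtype.ext (Prod.ext hp hq)

open Classical in
-- Each letter that occurs has exactly one extremal position: its last occurrence if negative, its
-- first if positive.
theorem card_extremal_sign {n : ℕ} (t : Fin n → ℕ ×ₗ Bool) (b : Bool) :
    (univ.filter fun i => IsExtremal t i ∧ (ofLex (t i)).2 = b).card =
      (signContent t b).support.card := by
  refine card_nbij (fun i => (ofLex (t i)).1) ?_ ?_ ?_
  · intro i hi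
    simp only [mem_coe, mem_filter, mem_univ, true_and] at hi
    rw [mem_coe, Finsupp.mem_support_iff, signContent_ne_zero_iff]
    exact ⟨i, by rw [← hi.2]; rfl⟩
  · intro i hi j hj h
    simp only [mem_coe, mem_filter, mem_univ, true_and] at hi hj
    have e : t i = t j := ofLex.injective (Prod.ext h (hi.2.trans hj.2.symm))
    cases b
    · rcases lt_trichotomy i j with hlt | rfl | hlt
      · exact absurd e.symm (hi.1.2 hi.2 j hlt)
      · rfl
      · exact absurd e (hj.1.2 hj.2 i hlt)
    · rcases lt_trichotomy i j with hlt | rfl | hlt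
      · exact absurd e (hj.1.1 hj.2 i hlt)
      · rfl
      · exact absurd e.symm (hi.1.1 hi.2 j hlt)
  · intro k hk
    rw [mem_coe, Finsupp.mem_support_iff, signContent_ne_zero_iff] at hk
    obtain ⟨j, hj⟩ := hk
    have hne : (univ.filter fun j => t j = toLex (k, b)).Nonempty := ⟨j, by simpa using hj⟩
    have key : ∀ i, t i = toLex (k, b) → IsExtremal t i →
        ∃ i ∈ ((univ.filter fun i => IsExtremal t i ∧ (ofLex (t i)).2 = b : Finset (Fin n)) :
          Set (Fin n)), (ofLex (t i)).1 = k := by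
      intro i hi hx
      refine ⟨i, ?_, by rw [hi]; rfl⟩
      simp only [mem_coe, mem_filter, mem_univ, true_and]
      exact ⟨hx, by rw [hi]; rfl⟩
    cases b
    · have hmem := max'_mem _ hne
      rw [mem_filter] at hmem
      refine key _ hmem.2 ⟨fun h => ?_, fun _ j hlt he => ?_⟩
      · rw [hmem.2] at h
        exact absurd h (by simp)
      · exact absurd (le_max' _ j (by simpa using he.trans hmem.2)) (not_le.2 hlt)
    · have hmem := min'_mem _ hne
      rw [mem_filter] at hmem
      refine key _ hmem.2 ⟨fun _ j hlt he => ?_, fun h => ?_⟩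
      · exact absurd (min'_le _ j (by simpa using he.trans hmem.2)) (not_le.2 hlt)
      · rw [hmem.2] at h
        exact absurd h (by simp)

theorem card_extremal {n : ℕ} (t : Fin n → ℕ ×ₗ Bool) : Nat.card {i // IsExtremal t i} =
    (signContent t false).support.card + (signContent t true).support.card := by
  classical
  rw [← card_extremal_sign, ← card_extremal_sign, Nat.card_eq_fintype_card, Fintype.card_subtype,
    ← card_filter_add_card_filter_not (fun i => (ofLex (t i)).2 = false), filter_filter,
    filter_filter]
  simp only [Bool.not_eq_false]

theorem card_pointed_signedWord {n : ℕ} {m : ℕ →₀ ℕ} (hm : m.degree = n) :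
    Nat.card {x : SignedWord n m × Fin n // IsExtremal x.1.1 x.2} = pointedCount m := by
  let e := Equiv.ofBijective _ (bijective_signContent hm)
  rw [Nat.card_congr (Equiv.subtypeProdEquivSigmaSubtype
    fun (t : SignedWord n m) i => IsExtremal t.1 i),
    ← Nat.card_congr (Equiv.sigmaCongrLeft e.symm), Nat.card_sigma, pointedCount,
    ← sum_coe_sort (signSplits m)]
  refine sum_congr rfl fun p _ => ?_
  rw [card_extremal]
  have : (⟨_, signContent_mem_signSplits (e.symm p)⟩ : signSplits m) = p := e.apply_symm_apply p
  rw [← congrArg Subtype.val this]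

theorem isEmpty_signedWord {n : ℕ} {m : ℕ →₀ ℕ} (hm : m.degree ≠ n) : IsEmpty (SignedWord n m) := by
  refine ⟨fun t => hm ?_⟩
  rw [← t.2.2.2, map_sum]
  simp [Finsupp.degree_single]

/-- The sequences counted by the coefficient of the monomial with exponent `m` in `F^B_I`. -/
abbrev IsChowSeq (n : ℕ) (I : Finset ℕ) (m : ℕ →₀ ℕ) (s : Fin (n + 1) → ℕ) : Prop :=
  s 0 = 0 ∧ Monotone s ∧ (∀ j : Fin n, (j : ℕ) ∈ I → s j.castSucc < s j.succ) ∧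
    ∑ j : Fin n, Finsupp.single (s j.succ) 1 = m

theorem finite_isChowSeq (n : ℕ) (I : Finset ℕ) (m : ℕ →₀ ℕ) :
    Finite {s // IsChowSeq n I m s} := by
  refine Set.Finite.subset (Set.Finite.pi' fun _ => (insert 0 m.support).finite_toSet) ?_
  rintro s ⟨h0, -, -, rfl⟩ j
  rw [mem_coe, mem_insert]
  rcases Fin.eq_zero_or_eq_succ j with rfl | ⟨j, rfl⟩
  · exact Or.inl h0
  · refine Or.inr ?_
    rw [Finsupp.mem_support_iff, Finsupp.finsetSum_apply]
    have := single_le_sum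
      (f := fun i : Fin n => (Finsupp.single (s i.succ) 1 : ℕ →₀ ℕ) (s j.succ))
      (fun _ _ => Nat.zero_le _) (mem_univ j)
    simp only [Finsupp.single_eq_same] at this
    omega

theorem quasi_apply {n : ℕ} (B : Finset (SignedPerm n)) (m : ℕ →₀ ℕ) : quasi B m =
    (Nat.card {x : B × (Fin (n + 1) → ℕ) // IsChowSeq n x.1.1.des m x.2} : ℂ) := by
  have := fun π : SignedPerm n => finite_isChowSeq n π.des m
  rw [Nat.card_congr (Equiv.subtypeProdEquivSigmaSubtype
    fun (π : B) (s : Fin (n + 1) → ℕ) => IsChowSeq n π.1.des m s), Nat.card_sigma,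
    sum_coe_sort B (fun π => Nat.card {s // IsChowSeq n π.des m s}), Nat.cast_sum]
  exact map_sum (MvPowerSeries.coeff m) _ B

/-- The position of the entry with absolute value one. -/
noncomputable def SignedPerm.mark {N : ℕ} (π : SignedPerm (N + 1)) : Fin (N + 1) :=
  (π.exists_natAbs_val_eq_one (by omega)).choose

theorem SignedPerm.natAbs_val_mark {N : ℕ} (π : SignedPerm (N + 1)) :
    (π.val (π.mark + 1)).natAbs = 1 :=
  (π.exists_natAbs_val_eq_one (by omega)).choose_spec

theorem mem_signedArc {n : ℕ} {π : SignedPerm n} : π ∈ signedArc n ↔ IsSignedArc π := by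
  simp [signedArc]

/-- The bijection attaches the signs of π to the Chow sequence and marks the position of ±1; neither
side keeps further information. -/
theorem card_chow_signedArc (N : ℕ) (m : ℕ →₀ ℕ) :
    Nat.card {x : signedArc (N + 1) × (Fin (N + 2) → ℕ) // IsChowSeq (N + 1) x.1.1.des m x.2} =
      Nat.card {x : SignedWord (N + 1) m × Fin (N + 1) // IsExtremal x.1.1 x.2} := by
  have key : ∀ x : {x : signedArc (N + 1) × (Fin (N + 2) → ℕ) //
      IsChowSeq (N + 1) x.1.1.des m x.2}, _ := fun x =>
    (chow_condition_iff (mem_signedArc.1 x.1.1.2) x.1.1.1.natAbs_val_mark x.2.1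
      (t := fun j => toLex (x.1.2 j.succ, x.1.1.1.signs j)) fun _ => rfl).1 ⟨x.2.2.1, x.2.2.2.1⟩
  refine Nat.card_eq_of_bijective (fun x =>
    ⟨(⟨fun j => toLex (x.1.2 j.succ, x.1.1.1.signs j), (key x).1, (key x).2.1, x.2.2.2.2⟩,
      x.1.1.1.mark), (key x).2.2⟩) ⟨?_, ?_⟩
  · rintro ⟨⟨⟨π, hπ⟩, s⟩, hs⟩ ⟨⟨⟨π', hπ'⟩, s'⟩, hs'⟩ h
    simp only [Subtype.mk.injEq, Prod.mk.injEq] at h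
    obtain ⟨ht, hmark⟩ := h
    have ht : ∀ j : Fin (N + 1), s j.succ = s' j.succ ∧ π.signs j = π'.signs j := by
      intro j
      have := toLex.injective (congrFun ht j)
      simpa using this
    have hss : s = s' := by
      funext j
      rcases Fin.eq_zero_or_eq_succ j with rfl | ⟨j, rfl⟩
      · exact hs.1.trans hs'.1.symm
      · exact (ht j).1
    have hππ : π = π' := by
      refine SignedPerm.eq_of_signs_eq (mem_signedArc.1 hπ) (mem_signedArc.1 hπ')
        (fun j hj => (ht ⟨j, hj⟩).2) π.mark.2 π.natAbs_val_mark ?_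
      rw [hmark]
      exact π'.natAbs_val_mark
    subst hss hππ
    rfl
  · rintro ⟨⟨⟨t, ht, ht0, htm⟩, i⟩, hi⟩
    obtain ⟨π, hπ, hsigns, hπi⟩ := SignedPerm.exists_signedArc (n := N + 1)
      (fun j => if h : j < N + 1 then (ofLex (t ⟨j, h⟩)).2 else true) i.2
    have hsigns : ∀ j : Fin (N + 1), π.signs j = (ofLex (t j)).2 := by
      intro j
      rw [hsigns j j.2, dif_pos j.2]
    have hmark : π.mark = i := by
      have := π.natAbs_val_injOn (i := π.mark + 1) (j := i + 1) (by omega) (by omega)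
        (π.natAbs_val_mark.trans hπi.symm)
      exact Fin.ext (by omega)
    let s : Fin (N + 2) → ℕ := Fin.cons 0 fun j => (ofLex (t j)).1
    have hs : ∀ j, t j = toLex (s j.succ, π.signs j) := by
      intro j
      rw [hsigns]
      rfl
    have hc := (chow_condition_iff hπ hπi (s := s) rfl hs).2 ⟨ht, ht0, hi⟩
    refine ⟨⟨(⟨π, mem_signedArc.2 hπ⟩, s), rfl, hc.1, hc.2, htm⟩, ?_⟩
    refine Subtype.ext (Prod.ext (Subtype.ext (funext fun j => (hs j).symm)) hmark)

theorem quasi_signedArc_apply {n : ℕ} (hn : 1 ≤ n) (m : ℕ →₀ ℕ) :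
    quasi (signedArc n) m = ((if m.degree = n then pointedCount m else 0 : ℕ) : ℂ) := by
  obtain ⟨N, rfl⟩ : ∃ N, n = N + 1 := ⟨n - 1, by omega⟩
  rw [quasi_apply, card_chow_signedArc]
  split_ifs with h
  · rw [card_pointed_signedWord h]
  · have := isEmpty_signedWord h
    rw [Nat.card_of_isEmpty]

/-! ### The main theorem -/

theorem card_famShape {n : ℕ} {x : ℕ ⊕ ℕ ⊕ ℕ} (hx : x ∈ famIndex n) :
    (famShape n x).card = 2 * n := by
  have key : ∀ {a b c e : ℕ}, b ≤ a → c ≤ b → e ≤ c →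
      (diagram [a, b, c, e]).card = a + b + c + e := by
    intro a b c e h1 h2 h3
    obtain ⟨p0, p1, p2, p3, p4⟩ := rowLen_diagram_four h1 h2 h3
    rw [card_eq_of_rowLen_four (p4 0), p0, p1, p2, p3]
  rcases x with b | b | b <;>
    simp only [mem_famIndex_inl, mem_famIndex_inr_inl, mem_famIndex_inr_inr] at hx <;>
    simp only [famShape] <;> (try split_ifs) <;>
    rw [key (by omega) (by omega) (by omega)] <;> omega

/-- In degree `n` both coefficients equal `pointedCount m`; in any other degree both vanish. -/
theorem quasi_signedArc_eq {n : ℕ} (hn : 1 ≤ n) : quasi (signedArc n) =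
    ∑ x ∈ famIndex n, famWeight n x • dominoFun (famShape n x) := by
  refine MvPowerSeries.ext fun m => ?_
  have h : ∀ x, MvPowerSeries.coeff m (famWeight n x • dominoFun (famShape n x)) =
      ((famWeight n x * tabCount (famShape n x) m : ℕ) : ℂ) := by
    intro x
    rw [map_nsmul, Nat.cast_mul, ← dominoFun_apply, nsmul_eq_mul]
    rfl
  rw [map_sum, sum_congr rfl fun x _ => h x, ← Nat.cast_sum]
  refine (quasi_signedArc_apply hn m).trans (congrArg _ ?_)
  split_ifs with h
  · subst h
    exact (famCount_famWeight m).symm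
  · refine (sum_eq_zero fun x hx => ?_).symm
    rw [tabCount_eq_zero, mul_zero]
    rw [card_famShape hx]
    omega

theorem exists_isLabelled_of_isStrip {k : ℕ} {μ ν : YoungDiagram} (hk : k ≠ 0) (hs : IsStrip μ ν)
    (h : ∃ L, IsLabelled μ L ∧ ∀ x ∈ L, x.2 < k) :
    ∃ L, IsLabelled ν L ∧ ∀ x ∈ L, x.2 < k + 1 := by
  obtain ⟨L, hL, hlt⟩ := h
  refine ⟨_, isLabelled_addStrip hL hlt hs fun h0 => absurd h0 hk, fun x hx => ?_⟩
  rcases mem_addStrip.1 hx with hx | ⟨-, hx⟩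
  · exact Nat.lt_succ_of_lt (hlt x hx)
  · omega

/-- A tableau is built by at most two strips: two-row shapes grow from the empty shape, the shapes
(a, b, 1, 1) from (1, 1), and all others from (2). Labels start at 1, so the corner condition holds
automatically. -/
theorem isDominoShape_famShape {n : ℕ} {x : ℕ ⊕ ℕ ⊕ ℕ} (hx : x ∈ famIndex n) :
    IsDominoShape n (famShape n x) := by
  suffices h : ∃ k L, IsLabelled (famShape n x) L ∧ ∀ x ∈ L, x.2 < k by
    obtain ⟨-, L, hL, -⟩ := h
    obtain ⟨T, -⟩ := hL.exists_ssdt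
    exact ⟨card_famShape hx, T.tiles, T.isTiling⟩
  have h0 : ∃ L, IsLabelled (famShape 0 (.inl 0)) L ∧ ∀ x ∈ L, x.2 < 1 := by
    have h := tabCount_zero (card_famShape (n := 0) (x := .inl 0) (mem_famIndex_inl.2 le_rfl))
    have : Nonempty (tabSet (famShape 0 (.inl 0)) 0) := by
      by_contra hne
      rw [not_nonempty_iff] at hne
      rw [tabCount, Nat.card_of_isEmpty] at h
      exact zero_ne_one h
    obtain ⟨L, hL, hw⟩ := this
    refine ⟨L, hL, fun x hx => ?_⟩
    have := labelWeight_ne_zero hx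
    rw [hw] at this
    exact absurd rfl this
  have h1 : ∀ b ≤ n, ∃ L, IsLabelled (famShape n (.inl b)) L ∧ ∀ x ∈ L, x.2 < 2 := by
    intro b hb
    refine exists_isLabelled_of_isStrip one_ne_zero ?_ h0
    have := (stripStep_inl_inl (k := 1) (n := 0) (d := n) one_ne_zero (b := b) le_rfl
      (by omega)).2 (by omega)
    rw [zero_add] at this
    exact this.1
  rcases x with b | b | b
  · exact ⟨2, h1 b (mem_famIndex_inl.1 hx)⟩
  all_goals
    simp only [mem_famIndex_inr_inl, mem_famIndex_inr_inr] at hx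
    obtain ⟨N, rfl⟩ : ∃ N, n = 1 + N := ⟨n - 1, by omega⟩
    clear h1
    have h1 : ∀ b ≤ 1, ∃ L, IsLabelled (famShape 1 (.inl b)) L ∧ ∀ x ∈ L, x.2 < 2 := by
      intro b hb
      refine exists_isLabelled_of_isStrip one_ne_zero ?_ h0
      exact ((stripStep_inl_inl (k := 1) (n := 0) (d := 1) one_ne_zero (b := b) le_rfl
        (by omega)).2 (by omega)).1
  · have hstep : StripStep 2 N (famShape 1 (.inl 1)) (famShape (1 + N) (.inr (.inl b))) := by
      simp only [famShape]
      rw [stripStep_diagram_iff (by omega) (by omega) (by omega) (by omega) (by omega) (by omega)]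
      omega
    exact ⟨3, exists_isLabelled_of_isStrip two_ne_zero hstep.1 (h1 1 le_rfl)⟩
  · have hstep : StripStep 2 N (famShape 1 (.inl 0)) (famShape (1 + N) (.inr (.inr b))) := by
      simp only [famShape]
      split_ifs <;>
        rw [stripStep_diagram_iff (by omega) (by omega) (by omega) (by omega) (by omega)
          (by omega)] <;> omega
    exact ⟨3, exists_isLabelled_of_isStrip two_ne_zero hstep.1 (h1 0 zero_le_one)⟩

theorem isGPositive_signedArc {n : ℕ} (hn : 1 ≤ n) : IsGPositive (signedArc n) := by
  refine ⟨∑ x ∈ famIndex n, Finsupp.single (famShape n x) (famWeight n x), ?_, ?_⟩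
  · intro μ hμ
    rw [Finsupp.mem_support_iff, Finsupp.finsetSum_apply] at hμ
    obtain ⟨x, hx, hne⟩ := exists_ne_zero_of_sum_ne_zero hμ
    rw [(Finsupp.single_apply_ne_zero.1 hne).1]
    exact isDominoShape_famShape hx
  · rw [quasi_signedArc_eq hn, ← Finsupp.sum_finsetSum_index]
    · exact sum_congr rfl fun x _ => (Finsupp.sum_single_index
      (h := fun μ k => k • dominoFun μ) (zero_smul ℕ _)).symm
    · exact fun μ => zero_smul ℕ _
    · exact fun μ a b => add_smul a b _

/-! ### The sum over the family in the form of the theorem -/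

theorem diagram_four_eq_three {a b c : ℕ} (h1 : b ≤ a) (h2 : c ≤ b) :
    diagram [a, b, c, 0] = diagram [a, b, c] :=
  diagram_append_zero (l := [a, b, c]) (sortedGE_four h1 h2 (Nat.zero_le _))

theorem diagram_four_eq_two {a b : ℕ} (h1 : b ≤ a) : diagram [a, b, 0, 0] = diagram [a, b] := by
  rw [diagram_four_eq_three h1 (Nat.zero_le _)]
  refine diagram_append_zero (l := [a, b]) ?_
  rw [List.sortedGE_iff_pairwise]
  simp
  omega

theorem diagram_four_eq_one (a : ℕ) : diagram [a, 0, 0, 0] = diagram [a] := by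
  rw [diagram_four_eq_two (Nat.zero_le _)]
  refine diagram_append_zero (l := [a]) ?_
  rw [List.sortedGE_iff_pairwise]
  simp

/-- The sums over the first row in the theorem are sums over the second row. -/
theorem sum_filter_firstRow {M : Type*} [AddCommMonoid M] (n : ℕ) (g : ℕ → ℕ → M) :
    ∑ a ∈ (range (2 * n + 1)).filter fun a => 2 * n - a - 2 ≤ a ∧ 2 ≤ 2 * n - a - 2,
      g a (2 * n - a - 2) = ∑ b ∈ Icc 2 (n - 1), g (2 * n - 2 - b) b := by
  refine sum_nbij' (fun a => 2 * n - a - 2) (fun b => 2 * n - 2 - b) ?_ ?_ ?_ ?_ ?_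
  · intro a ha
    simp only [mem_filter, mem_range, mem_Icc] at ha ⊢
    omega
  · intro b hb
    simp only [mem_filter, mem_range, mem_Icc] at hb ⊢
    omega
  · intro a ha
    simp only [mem_filter, mem_range] at ha
    omega
  · intro b hb
    simp only [mem_Icc] at hb
    omega
  · intro a ha
    simp only [mem_filter, mem_range] at ha
    congr 1
    omega

theorem sum_filter_firstRow_two {M : Type*} [AddCommMonoid M] (n : ℕ) (g : ℕ → ℕ → M) :
    ∑ a ∈ (range (2 * n + 1)).filter fun a => 2 * n - a ≤ a ∧ 2 ≤ 2 * n - a,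
      g a (2 * n - a) = ∑ b ∈ Icc 2 n, g (2 * n - b) b := by
  refine sum_nbij' (fun a => 2 * n - a) (fun b => 2 * n - b) ?_ ?_ ?_ ?_ ?_
  · intro a ha
    simp only [mem_filter, mem_range, mem_Icc] at ha ⊢
    omega
  · intro b hb
    simp only [mem_filter, mem_range, mem_Icc] at hb ⊢
    omega
  · intro a ha
    simp only [mem_filter, mem_range] at ha
    omega
  · intro b hb
    simp only [mem_Icc] at hb
    omega
  · intro a ha
    simp only [mem_filter, mem_range] at ha
    congr 1
    omega

theorem quasi_signedArc_one :
    quasi (signedArc 1) = dominoFun (diagram [2]) + dominoFun (diagram [1, 1]) := by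
  have h : famIndex 1 = {.inl 0, .inl 1} := by decide
  rw [quasi_signedArc_eq le_rfl, h, sum_pair (by decide)]
  simp only [famShape, famWeight]
  rw [diagram_four_eq_one, diagram_four_eq_two (by omega)]
  simp

theorem quasi_signedArc_of_two_le {n : ℕ} (hn : 2 ≤ n) : quasi (signedArc n) =
    dominoFun (diagram [2 * n]) + dominoFun (diagram [2 * n - 1, 1])
      + dominoFun (diagram [2 * n - 2, 1, 1]) + dominoFun (diagram [2 * n - 3, 1, 1, 1])
      + 2 * ∑ b ∈ Icc 2 n, dominoFun (diagram [2 * n - b, b])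
      + ∑ b ∈ Icc 2 (n - 1), dominoFun (diagram [2 * n - 2 - b, b, 2])
      + ∑ b ∈ Icc 2 (n - 1), dominoFun (diagram [2 * n - 2 - b, b, 1, 1]) := by
  have s1 : range (n + 1) = insert 0 (insert 1 (Icc 2 n)) := by
    ext b
    simp only [mem_range, mem_insert, mem_Icc]
    omega
  have s2 : Icc 1 (n - 1) = insert 1 (Icc 2 (n - 1)) := by
    ext b
    simp only [mem_insert, mem_Icc]
    omega
  have s3 : ((range n).filter fun b => b ≠ 1 ∧ 2 ≤ n) = insert 0 (Icc 2 (n - 1)) := by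
    ext b
    simp only [mem_filter, mem_range, mem_insert, mem_Icc]
    omega
  have e1 : ∑ b ∈ range (n + 1), famWeight n (.inl b) • dominoFun (famShape n (.inl b)) =
      dominoFun (diagram [2 * n]) + (dominoFun (diagram [2 * n - 1, 1]) +
        2 * ∑ b ∈ Icc 2 n, dominoFun (diagram [2 * n - b, b])) := by
    rw [s1, sum_insert (by simp), sum_insert (by simp), mul_sum]
    refine congrArg₂ _ ?_ (congrArg₂ _ ?_ (sum_congr rfl fun b hb => ?_))
    · simp only [famShape, famWeight, if_true]
      rw [if_neg (by omega), one_smul, Nat.sub_zero, diagram_four_eq_one]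
    · simp only [famShape, famWeight]
      simp only [if_true]
      rw [if_neg one_ne_zero, one_smul, diagram_four_eq_two (by omega)]
    · rw [mem_Icc] at hb
      simp only [famShape, famWeight]
      rw [if_neg (by omega), if_neg (by omega), two_nsmul, ← two_mul,
        diagram_four_eq_two (by omega)]
  have e2 : ∑ b ∈ Icc 1 (n - 1),
      famWeight n (.inr (.inl b)) • dominoFun (famShape n (.inr (.inl b))) =
      dominoFun (diagram [2 * n - 3, 1, 1, 1]) +
        ∑ b ∈ Icc 2 (n - 1), dominoFun (diagram [2 * n - 2 - b, b, 1, 1]) := by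
    rw [s2, sum_insert (by simp)]
    simp only [famShape, famWeight, one_smul, Nat.sub_sub]
  have e3 : ∑ b ∈ (range n).filter (fun b => b ≠ 1 ∧ 2 ≤ n),
      famWeight n (.inr (.inr b)) • dominoFun (famShape n (.inr (.inr b))) =
      dominoFun (diagram [2 * n - 2, 1, 1]) +
        ∑ b ∈ Icc 2 (n - 1), dominoFun (diagram [2 * n - 2 - b, b, 2]) := by
    rw [s3, sum_insert (by simp)]
    refine congrArg₂ _ ?_ (sum_congr rfl fun b hb => ?_)
    · simp only [famShape, famWeight, one_smul, if_true]
      rw [diagram_four_eq_three (by omega) le_rfl]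
    · rw [mem_Icc] at hb
      simp only [famShape, famWeight, one_smul]
      rw [if_neg (by omega), diagram_four_eq_three (by omega) (by omega)]
  rw [quasi_signedArc_eq (by omega), famIndex, sum_disjSum, sum_disjSum, e1, e2, e3]
  ring

theorem mainTheorem1 (n : ℕ) (hn : 1 ≤ n) :
    IsGPositive (signedArc n) ∧
    (n = 1 → quasi (signedArc n) = dominoFun (diagram [2]) + dominoFun (diagram [1, 1])) ∧
    (2 ≤ n → quasi (signedArc n) =
      dominoFun (diagram [2 * n]) + dominoFun (diagram [2 * n - 1, 1])
      + dominoFun (diagram [2 * n - 2, 1, 1]) + dominoFun (diagram [2 * n - 3, 1, 1, 1])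
      + 2 * ∑ a ∈ (Finset.range (2 * n + 1)).filter (fun a => 2 * n - a ≤ a ∧ 2 ≤ 2 * n - a),
          dominoFun (diagram [a, 2 * n - a])
      + ∑ a ∈ (Finset.range (2 * n + 1)).filter
            (fun a => 2 * n - a - 2 ≤ a ∧ 2 ≤ 2 * n - a - 2),
          dominoFun (diagram [a, 2 * n - a - 2, 2])
      + ∑ a ∈ (Finset.range (2 * n + 1)).filter
            (fun a => 2 * n - a - 2 ≤ a ∧ 2 ≤ 2 * n - a - 2),
          dominoFun (diagram [a, 2 * n - a - 2, 1, 1])) := by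
  refine ⟨isGPositive_signedArc hn, ?_, fun h => ?_⟩
  · rintro rfl
    exact quasi_signedArc_one
  · rw [quasi_signedArc_of_two_le h,
      sum_filter_firstRow_two n fun a b => dominoFun (diagram [a, b]),
      sum_filter_firstRow n fun a b => dominoFun (diagram [a, b, 2]),
      sum_filter_firstRow n fun a b => dominoFun (diagram [a, b, 1, 1])]
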